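/- Work in the category of compactly generated spaces (products, fibre products and subspaces carry the compactly generated topology), so that a topological groupoid is a groupoid object in this category. For topological groupoids $H$ and $K$ let $\operatorname{Hom}(H,K)$ be the groupoid of continuous functors $H\to K$ and continuous natural transformations. A principal $G$-bundle on $H$ is a space $P\to H_0$ with local sections and an action of $G$ along the fibres (over an anchor map $P\to G_0$) which is simply transitive on the fibres with continuous translation function $P\times_{H_0}P\to G_1$, together with an action of $H$ on $P$ which covers the action of $H$ on $H_0$ and commutes with that of $G$; let $\mathcal M_G(H)$ be the groupoid of principal $G$-bundles on $H$ and their isomorphisms. Let $\mathbb EG=G\ltimes G_1$ be the translation groupoid, $\|-\|$ the fat geometric realization of the nerve, and let the fibrant replacement $$\operatorname{fib}(G)=\bigl((\|\mathbb EG\|\times_{G_0}\|\mathbb EG\|)/G\rightrightarrows\|G\|\bigr)$$ be the gauge groupoid of the universal principal $G$-bundle $\|\mathbb EG\|\to\|G\|$. Corollary 3.1. Let $H$ and $G$ be topological groupoids (for instance simplicial groupoids, i.e. topological groupoids which are colimits of towers of saturated inclusions) such that $H_0$ is paracompact Hausdorff and $G_0$ is weakly Hausdorff. Then there is an equivalence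 of groupoids $$\operatorname{Hom}(H,\operatorname{fib}G)\simeq\mathcal M_G(H),$$ natural in $H$ and in $G$. Naturality means the following. For continuous functors $\varphi:H\to H'$, $\psi:G\to G'$, every natural transformation $\operatorname{fib}(\psi)\circ F\Rightarrow F'\circ\varphi$ between functors $F:H\to\operatorname{fib}G$ and $F':H'\to\operatorname{fib}G'$ induces a map covering $\varphi$ and $\psi$, equivariant for all actions, from the bundle of $F$ to the bundle of $F'$; this is compatible with composition, and it is the given equivalence when $\varphi$ and $\psi$ are identities. -/

import Mathlib

open Set Topology

universe u

namespace TopGpd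

/-! ### Compactly generated spaces -/

/-- A space is weakly Hausdorff if the image of every continuous map from a compact Hausdorff space
is closed. -/
class WeaklyHausdorff (X : Type u) [TopologicalSpace X] : Prop where
  isClosed_range : ∀ (K : Type u) [TopologicalSpace K] [CompactSpace K] [T2Space K] (f : K → X),
    Continuous f → IsClosed (range f)

/-- The space `X` with its topology replaced by the associated compactly generated topology. -/
@[ext]
structure Kify (X : Type u) [TopologicalSpace X] : Type u where
  /-- A point of `X`, seen in the space with the compactly generated topology. -/
  mk ::
  /-- The underlying point of `X`. -/
  out : X

instance (X : Type u) [TopologicalSpace X] : TopologicalSpace (Kify X) :=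
  (TopologicalSpace.compactlyGenerated.{u} X).coinduced Kify.mk

section Kify

variable {X Y Z : Type u} [TopologicalSpace X] [TopologicalSpace Y] [TopologicalSpace Z]

theorem Kify.continuous_out : Continuous (Kify.out : Kify X → X) := by
  rw [continuous_coinduced_dom]
  exact continuous_from_compactlyGenerated _ fun _ g => g.continuous

theorem Kify.continuous_comp_mk {K : Type u} [TopologicalSpace K] [CompactSpace K] [T2Space K]
    {f : K → X} (hf : Continuous f) : Continuous (fun k => Kify.mk (f k)) := by
  let F : (Σ (i : (S : CompHaus.{u}) × C(S, X)), i.fst) → X := fun ⟨⟨_, i⟩, s⟩ ↦ i s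
  have h1 : Continuous (fun x => Kify.mk (F x)) :=
    continuous_iff_coinduced_le.mpr (coinduced_compose (f := F) (g := Kify.mk)).ge
  have h2 : Continuous (fun k : K =>
      (⟨⟨CompHaus.of K, ⟨f, hf⟩⟩, k⟩ : (Σ (i : (S : CompHaus.{u}) × C(S, X)), i.fst))) :=
    continuous_sigmaMk (σ := fun i : (S : CompHaus.{u}) × C(S, X) => (i.fst : Type u))
      (i := ⟨CompHaus.of K, ⟨f, hf⟩⟩)
  exact h1.comp h2

instance : CompactlyGeneratedSpace (Kify X) :=
  compactlyGeneratedSpace_of_continuous_maps fun f h => by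
    rw [continuous_coinduced_dom]
    refine continuous_from_compactlyGenerated (X := X) _ fun S g => ?_
    exact h S (fun s => Kify.mk (g s)) (Kify.continuous_comp_mk g.continuous)

/-- Continuity of a map out of a compactly generated space into `Kify Y`. -/
theorem Kify.continuous_mk_comp [CompactlyGeneratedSpace X] {f : X → Y}
    (hf : ∀ (K : Type u) [TopologicalSpace K] [CompactSpace K] [T2Space K] (a : K → X),
      Continuous a → Continuous fun k => f (a k)) : Continuous fun x => Kify.mk (f x) :=
  continuous_from_compactlyGeneratedSpace _ fun K _ _ _ a ha =>
    Kify.continuous_comp_mk (hf K a ha)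

end Kify

section Lemmas

variable {X Y Z : Type u} [TopologicalSpace X] [TopologicalSpace Y] [TopologicalSpace Z]

/-- A map is continuous at a point if it is continuous on the compact sets which lie in a fixed
neighbourhood of the point. -/
theorem continuousAt_of_test {K : Type u} [TopologicalSpace K] [CompactSpace K] [T2Space K]
    {f : K → Z} {k : K} {V : Set K} (hV : V ∈ 𝓝 k)
    (hf : ∀ (N : Set K), CompactSpace N → N ⊆ V → Continuous fun n : N => f n) :
    ContinuousAt f k := by
  obtain ⟨N, hN, hNV, hNc⟩ := local_compact_nhds hV
  have := hf N (isCompact_iff_compactSpace.mp hNc) hNV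
  exact (continuousOn_iff_continuous_domRestrict.mpr this).continuousAt hN

theorem continuousOn_of_test [CompactlyGeneratedSpace X] {f : X → Z} {O : Set X} (hO : IsOpen O)
    (hf : ∀ (K : Type u) [TopologicalSpace K] [CompactSpace K] [T2Space K] (a : K → X),
      Continuous a → (∀ k, a k ∈ O) → Continuous fun k => f (a k)) : ContinuousOn f O := by
  refine (continuousOn_open_iff hO).mpr fun W hW => ?_
  refine CompactlyGeneratedSpace.isOpen' fun K _ _ _ a ha => ?_
  refine isOpen_iff_mem_nhds.mpr fun k hk => ?_
  have h : ContinuousAt (fun k => f (a k)) k :=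
    continuousAt_of_test ((hO.preimage ha).mem_nhds hk.1) fun N _ hN =>
      hf N (fun n => a n) (ha.comp continuous_subtype_val) fun n => hN n.2
  filter_upwards [(hO.preimage ha).mem_nhds hk.1, h (hW.mem_nhds hk.2)] with l h1 h2
  exact ⟨h1, h2⟩

theorem continuousOn_of_quotient {q : X → Y} (hq : IsQuotientMap q) {f : Y → Z} {O : Set Y}
    (hO : IsOpen O) (hf : ContinuousOn (fun x => f (q x)) (q ⁻¹' O)) : ContinuousOn f O := by
  refine (continuousOn_open_iff hO).mpr fun W hW => ?_
  rw [← hq.isOpen_preimage]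
  exact (continuousOn_open_iff (hO.preimage hq.continuous)).mp hf W hW

theorem WeaklyHausdorff.isClosed_eq [WeaklyHausdorff X] {K : Type u} [TopologicalSpace K]
    [CompactSpace K] [T2Space K] {a b : K → X} (ha : Continuous a) (hb : Continuous b) :
    IsClosed {k | a k = b k} := by
  refine isOpen_compl_iff.mp (isOpen_iff_mem_nhds.mpr fun k hk => ?_)
  have hpt : IsClosed ({a k} : Set X) := by
    have := isClosed_range PUnit.{u+1} (fun _ => a k) continuous_const
    rwa [range_const] at this
  have hV : b ⁻¹' {a k}ᶜ ∈ 𝓝 k :=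
    (hpt.isOpen_compl.preimage hb).mem_nhds fun h => hk h.symm
  obtain ⟨N, hN, hNV, hNc⟩ := local_compact_nhds hV
  have := isCompact_iff_compactSpace.mp hNc
  have hcl : IsClosed (range fun n : N => b n) :=
    isClosed_range N _ (hb.comp continuous_subtype_val)
  have h2 : a ⁻¹' (range fun n : N => b n)ᶜ ∈ 𝓝 k := by
    refine (hcl.isOpen_compl.preimage ha).mem_nhds ?_
    rintro ⟨n, hn⟩
    exact hNV n.2 hn
  filter_upwards [hN, h2] with l h1 h2 h3
  exact h2 ⟨⟨l, h1⟩, h3.symm⟩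

/-- In the category of compactly generated spaces, pulling back along a map to a weakly Hausdorff
space preserves quotient maps. -/
theorem continuous_of_quotient_fibreProduct {E B T : Type u} [TopologicalSpace E]
    [TopologicalSpace B] [TopologicalSpace T] [WeaklyHausdorff B] [CompactlyGeneratedSpace Z]
    {q : Z → E} (hq : IsQuotientMap q) {p : E → B} (hp : Continuous p) {τ : Y → B}
    (hτ : Continuous τ) (act : E → Y → T)
    (hact : ∀ (L : Type u) [TopologicalSpace L] [CompactSpace L] [T2Space L] (z : L → Z)
      (y : L → Y), Continuous z → Continuous y → (∀ l, p (q (z l)) = τ (y l)) →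
      Continuous fun l => act (q (z l)) (y l))
    (K : Type u) [TopologicalSpace K] [CompactSpace K] [T2Space K] (e : K → E) (y : K → Y)
    (he : Continuous e) (hy : Continuous y) (h : ∀ k, p (e k) = τ (y k)) :
    Continuous fun k => act (e k) (y k) := by
  refine continuous_def.mpr fun W hW => ?_
  let O : Set (Z × K) := {zk | p (q zk.1) = τ (y zk.2) → act (q zk.1) (y zk.2) ∈ W}
  have hO : ∀ (L : Type u) [TopologicalSpace L] [CompactSpace L] [T2Space L] (f : L → Z × K),
      Continuous f → IsOpen (f ⁻¹' O) := by
    intro L _ _ _ f hf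
    let D : Set L := {l | p (q (f l).1) = τ (y (f l).2)}
    have hD : IsClosed D := WeaklyHausdorff.isClosed_eq
      (hp.comp (hq.continuous.comp hf.fst)) (hτ.comp (hy.comp hf.snd))
    have : CompactSpace D := isCompact_iff_compactSpace.mp hD.isCompact
    have hc := hact D (fun l => (f l).1) (fun l => y (f l).2)
      (hf.fst.comp continuous_subtype_val) (hy.comp (hf.snd.comp continuous_subtype_val))
      (fun l => l.2)
    have hcl := hD.isClosedEmbedding_subtypeVal.isClosedMap _ (hW.isClosed_compl.preimage hc)
    convert hcl.isOpen_compl using 1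
    ext l
    simp only [mem_preimage, mem_compl_iff, mem_image, Subtype.exists, not_exists, not_and]
    constructor
    · rintro hl m hm hmW rfl
      exact hmW (hl hm)
    · intro hl hm
      by_contra hW'
      exact hl l hm hW' rfl
  refine isOpen_iff_mem_nhds.mpr fun k hk => ?_
  obtain ⟨z, hz⟩ := hq.surjective (e k)
  have h1 : {k' | (z, k') ∈ O} ∈ 𝓝 k := by
    refine (hO K (fun k' => (z, k')) (by fun_prop)).mem_nhds ?_
    intro _
    rw [hz]
    exact hk
  obtain ⟨N, hN, hNV, hNc⟩ := local_compact_nhds h1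
  have := isCompact_iff_compactSpace.mp hNc
  let V : Set E := {x | ∀ n ∈ N, p x = τ (y n) → act x (y n) ∈ W}
  have hV : IsOpen V := by
    rw [← hq.isOpen_preimage]
    refine CompactlyGeneratedSpace.isOpen' fun L _ _ _ f hf => ?_
    have h2 : IsOpen ((fun ln : L × N => (f ln.1, (ln.2 : K))) ⁻¹' O) :=
      hO (L × N) _ (by fun_prop)
    have h3 := isClosedMap_fst_of_compactSpace (X := L) (Y := N) _ h2.isClosed_compl
    convert h3.isOpen_compl using 1
    ext l
    simp only [V, O, mem_preimage, mem_ofPred_eq, mem_compl_iff, mem_image, Prod.exists, not_exists,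
      exists_and_right, exists_eq_right, not_not, Subtype.forall]
  have hkV : e k ∈ V := by
    intro n hn hpn
    have := hNV hn
    simp only [O, mem_ofPred_eq, hz] at this
    exact this hpn
  filter_upwards [hN, (hV.preimage he).mem_nhds hkV] with l h4 h5
  exact h5 l h4 (h l)

end Lemmas

/-! ### Fat geometric realization -/

/-- A semisimplicial space: a contravariant functor from the category of the ordered sets
`{0, …, n}` and injective monotone maps to compactly generated spaces. -/
structure SemiSimplicialSpace : Type (u + 1) where
  /-- The space of `n`-simplices. -/
  obj : ℕ → Type u
  [top : ∀ n, TopologicalSpace (obj n)]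
  [cg : ∀ n, CompactlyGeneratedSpace (obj n)]
  /-- The action of injective monotone maps. -/
  map : ∀ {m n : ℕ}, (Fin (m + 1) ↪o Fin (n + 1)) → obj n → obj m
  continuous_map : ∀ {m n : ℕ} (θ : Fin (m + 1) ↪o Fin (n + 1)), Continuous (map θ)
  map_id : ∀ {n : ℕ} (x : obj n), map (RelEmbedding.refl (· ≤ ·)) x = x
  map_comp : ∀ {l m n : ℕ} (η : Fin (l + 1) ↪o Fin (m + 1)) (θ : Fin (m + 1) ↪o Fin (n + 1))
    (x : obj n), map (η.trans θ) x = map η (map θ x)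

attribute [instance] SemiSimplicialSpace.top SemiSimplicialSpace.cg

/-- The geometric `n`-simplex. -/
abbrev Simplex (n : ℕ) : Type := stdSimplex ℝ (Fin (n + 1))

/-- The disjoint union of the spaces `Δⁿ × Xₙ` (products of compactly generated spaces). -/
abbrev PreRealization (X : SemiSimplicialSpace.{u}) : Type u :=
  Σ n : ℕ, Kify (Simplex n × X.obj n)

/-- The gluing relation `(t, θ^* x) ∼ (θ_* t, x)` of the fat geometric realization. -/
inductive GlueRel (X : SemiSimplicialSpace.{u}) : PreRealization X → PreRealization X → Prop
  | glue {m n : ℕ} (θ : Fin (m + 1) ↪o Fin (n + 1)) (t : Simplex m) (x : X.obj n) :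
      GlueRel X ⟨m, ⟨(t, X.map θ x)⟩⟩ ⟨n, ⟨(stdSimplex.map θ t, x)⟩⟩

/-- The fat geometric realization of a semisimplicial space: the quotient of `∐ₙ Δⁿ × Xₙ` by the
relation generated by `(t, θ^* x) ∼ (θ_* t, x)`, `θ` injective and monotone, with the quotient
topology. -/
def FatRealization (X : SemiSimplicialSpace.{u}) : Type u := Quot (GlueRel X)

namespace FatRealization

variable {X : SemiSimplicialSpace.{u}}

instance : TopologicalSpace (FatRealization X) :=
  inferInstanceAs (TopologicalSpace (Quot (GlueRel X)))

/-- The class of a point `(t, x)` of `Δⁿ × Xₙ`. -/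
def mk {n : ℕ} (t : Simplex n) (x : X.obj n) : FatRealization X := Quot.mk _ ⟨n, ⟨(t, x)⟩⟩

/-- The quotient map. -/
def proj (z : PreRealization X) : FatRealization X := Quot.mk _ z

theorem isQuotientMap_proj : IsQuotientMap (proj : PreRealization X → FatRealization X) :=
  isQuotientMap_quot_mk

instance : CompactlyGeneratedSpace (FatRealization X) :=
  uCompactlyGeneratedSpace_of_coinduced (isQuotientMap_proj (X := X)).continuous
    (isQuotientMap_proj (X := X)).eq_coinduced

theorem ind {p : FatRealization X → Prop} (h : ∀ (n : ℕ) (t : Simplex n) (x : X.obj n), p (mk t x))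
    (b : FatRealization X) : p b := by
  obtain ⟨n, ⟨t, x⟩⟩ := b
  exact h n t x

theorem glue {m n : ℕ} (θ : Fin (m + 1) ↪o Fin (n + 1)) (t : Simplex m) (x : X.obj n) :
    mk t (X.map θ x) = mk (stdSimplex.map θ t) x := Quot.sound (GlueRel.glue θ t x)

/-- Descend a function to the fat realization. -/
def lift {Z : Type*} (f : ∀ n : ℕ, Simplex n → X.obj n → Z)
    (hf : ∀ ⦃m n : ℕ⦄ (θ : Fin (m + 1) ↪o Fin (n + 1)) (t : Simplex m) (x : X.obj n),
      f m t (X.map θ x) = f n (stdSimplex.map θ t) x) : FatRealization X → Z :=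
  Quot.lift (fun z => f z.1 z.2.out.1 z.2.out.2) (by rintro _ _ ⟨θ, t, x⟩; exact hf θ t x)

theorem continuous_lift {Z : Type u} [TopologicalSpace Z] {f : ∀ n : ℕ, Simplex n → X.obj n → Z}
    {hf : ∀ ⦃m n : ℕ⦄ (θ : Fin (m + 1) ↪o Fin (n + 1)) (t : Simplex m) (x : X.obj n),
      f m t (X.map θ x) = f n (stdSimplex.map θ t) x}
    (hc : ∀ n, Continuous fun z : Kify (Simplex n × X.obj n) => f n z.out.1 z.out.2) :
    Continuous (lift f hf) :=
  continuous_quot_lift _ (continuous_sigma hc)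

theorem continuous_mk_comp {n : ℕ} {K : Type u} [TopologicalSpace K] [CompactSpace K] [T2Space K]
    {t : K → Simplex n} {x : K → X.obj n} (ht : Continuous t) (hx : Continuous x) :
    Continuous fun k => mk (t k) (x k) :=
  isQuotientMap_proj.continuous.comp (continuous_sigmaMk.comp
    (Kify.continuous_comp_mk (ht.prodMk hx)))

theorem simplexMap_apply {m n : ℕ} (θ : Fin (m + 1) ↪o Fin (n + 1)) (t : Simplex m)
    (i : Fin (m + 1)) : stdSimplex.map θ t (θ i) = t i := by
  classical
  rw [stdSimplex.map_coe, FunOnFinite.linearMap_apply_apply]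
  have : (Finset.univ.filter fun j => θ j = θ i) = {i} := by
    ext j; simp [θ.injective.eq_iff]
  rw [this, Finset.sum_singleton]

theorem simplexMap_apply_eq_zero {m n : ℕ} (θ : Fin (m + 1) ↪o Fin (n + 1)) (t : Simplex m)
    (j : Fin (n + 1)) (hj : ∀ i, θ i ≠ j) : stdSimplex.map θ t j = 0 := by
  classical
  rw [stdSimplex.map_coe, FunOnFinite.linearMap_apply_apply]
  have : (Finset.univ.filter fun i => θ i = j) = ∅ := by
    ext i; simp [hj i]
  rw [this, Finset.sum_empty]

/-! Local charts of the fat realization, given by the first vertex of weight greater than `ε`. -/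

open scoped NNReal

/-- `i` is the first vertex of weight greater than `ε`, or the first vertex of positive weight in
case that all weights are at most `ε`. -/
def IsLead (ε : ℝ≥0) {n : ℕ} (t : Simplex n) (i : Fin (n + 1)) : Prop :=
  (ε < t i ∧ ∀ j < i, t j ≤ ε) ∨ ((∀ j, t j ≤ ε) ∧ 0 < t i ∧ ∀ j < i, t j = 0)

theorem exists_isLead (ε : ℝ≥0) {n : ℕ} (t : Simplex n) : ∃ i, IsLead ε t i := by
  classical
  have key : ∀ c : ℝ, (∃ i, c < t i) → ∃ i, c < t i ∧ ∀ j < i, t j ≤ c := by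
    intro c hc
    obtain ⟨i, hi, hmin⟩ := WellFounded.has_min (wellFounded_lt (α := Fin (n + 1))) {i | c < t i} hc
    exact ⟨i, hi, fun j hj => not_lt.mp fun h => hmin j h hj⟩
  by_cases h : ∃ i, (ε : ℝ) < t i
  · obtain ⟨i, hi⟩ := key ε h
    exact ⟨i, Or.inl hi⟩
  · push Not at h
    have h0 : ∃ i, 0 < t i := by
      by_contra! h0
      have := stdSimplex.sum_eq_one t
      rw [Finset.sum_eq_zero fun i _ => le_antisymm (h0 i) (stdSimplex.zero_le t i)] at this
      exact zero_ne_one this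
    obtain ⟨i, hi, hi'⟩ := key 0 h0
    exact ⟨i, Or.inr ⟨h, hi, fun j hj => le_antisymm (hi' j hj) (stdSimplex.zero_le t j)⟩⟩

theorem IsLead.unique {ε : ℝ≥0} {n : ℕ} {t : Simplex n} {i j : Fin (n + 1)} (hi : IsLead ε t i)
    (hj : IsLead ε t j) : i = j := by
  rcases lt_trichotomy i j with h | h | h
  · rcases hi with ⟨h1, h2⟩ | ⟨h1, h2, h3⟩ <;> rcases hj with ⟨h4, h5⟩ | ⟨h4, h5, h6⟩
    · exact absurd (h5 i h) (not_le.mpr h1)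
    · exact absurd (h4 i) (not_le.mpr h1)
    · exact absurd (h1 j) (not_le.mpr h4)
    · exact absurd (h6 i h) h2.ne'
  · exact h
  · rcases hi with ⟨h1, h2⟩ | ⟨h1, h2, h3⟩ <;> rcases hj with ⟨h4, h5⟩ | ⟨h4, h5, h6⟩
    · exact absurd (h2 j h) (not_le.mpr h4)
    · exact absurd (h4 i) (not_le.mpr h1)
    · exact absurd (h1 j) (not_le.mpr h4)
    · exact absurd (h3 j h) h5.ne'

/-- The leading vertex. -/
noncomputable def lead (ε : ℝ≥0) {n : ℕ} (t : Simplex n) : Fin (n + 1) := (exists_isLead ε t).choose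

theorem isLead_lead (ε : ℝ≥0) {n : ℕ} (t : Simplex n) : IsLead ε t (lead ε t) :=
  (exists_isLead ε t).choose_spec

theorem IsLead.map {ε : ℝ≥0} {m n : ℕ} (θ : Fin (m + 1) ↪o Fin (n + 1)) {t : Simplex m}
    {i : Fin (m + 1)} (h : IsLead ε t i) : IsLead ε (stdSimplex.map θ t) (θ i) := by
  have key : ∀ (p : ℝ → Prop), p 0 → ∀ j : Fin (n + 1), (∀ k, θ k = j → p (t k)) →
      p (stdSimplex.map θ t j) := by
    intro p h0 j hj
    by_cases h : ∃ k, θ k = j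
    · obtain ⟨k, rfl⟩ := h
      rw [simplexMap_apply]
      exact hj k rfl
    · push Not at h
      rw [simplexMap_apply_eq_zero θ t j h]
      exact h0
  rcases h with ⟨h1, h2⟩ | ⟨h1, h2, h3⟩
  · refine Or.inl ⟨by rwa [simplexMap_apply], fun j hj => key (· ≤ (ε : ℝ)) ε.2 j ?_⟩
    rintro k rfl
    exact h2 k (θ.lt_iff_lt.mp hj)
  · refine Or.inr ⟨fun j => key (· ≤ (ε : ℝ)) ε.2 j fun k _ => h1 k, by rwa [simplexMap_apply],
      fun j hj => key (· = 0) rfl j ?_⟩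
    rintro k rfl
    exact h3 k (θ.lt_iff_lt.mp hj)

theorem lead_map (ε : ℝ≥0) {m n : ℕ} (θ : Fin (m + 1) ↪o Fin (n + 1)) (t : Simplex m) :
    lead ε (stdSimplex.map θ t) = θ (lead ε t) :=
  (isLead_lead ε _).unique ((isLead_lead ε t).map θ)

/-- The set of points with a vertex of weight greater than `ε` before which all weights are less
than `ε`. -/
def chartSet (X : SemiSimplicialSpace.{u}) (ε : ℝ≥0) : Set (FatRealization X) :=
  {b | lift (fun n t _ => 0 < ε ∧ ∃ i : Fin (n + 1), ε < t i ∧ ∀ j < i, t j < ε)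
    (by
      intro m n θ t x
      refine propext (and_congr_right fun hε => ⟨?_, ?_⟩)
      · rintro ⟨i, h1, h2⟩
        refine ⟨θ i, by rwa [simplexMap_apply], fun j hj => ?_⟩
        by_cases h : ∃ k, θ k = j
        · obtain ⟨k, rfl⟩ := h
          rw [simplexMap_apply]
          exact h2 k (θ.lt_iff_lt.mp hj)
        · push Not at h
          rw [simplexMap_apply_eq_zero θ t j h]
          exact_mod_cast hε
      · rintro ⟨i, h1, h2⟩
        by_cases h : ∃ k, θ k = i
        · obtain ⟨k, rfl⟩ := h
          rw [simplexMap_apply] at h1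
          refine ⟨k, h1, fun j hj => ?_⟩
          have := h2 (θ j) (θ.lt_iff_lt.mpr hj)
          rwa [simplexMap_apply] at this
        · push Not at h
          rw [simplexMap_apply_eq_zero θ t i h] at h1
          exact absurd ε.2 (not_le.mpr h1)) b}

theorem mk_mem_chartSet {ε : ℝ≥0} {n : ℕ} {t : Simplex n} {x : X.obj n} :
    mk t x ∈ chartSet X ε ↔ 0 < ε ∧ ∃ i : Fin (n + 1), ε < t i ∧ ∀ j < i, t j < ε := Iff.rfl

theorem continuous_coord {n : ℕ} (i : Fin (n + 1)) : Continuous fun t : Simplex n => t i :=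
  (continuous_apply i).comp continuous_subtype_val

theorem isOpen_lead {n : ℕ} (ε : ℝ≥0) (i : Fin (n + 1)) :
    IsOpen {t : Simplex n | ε < t i ∧ ∀ j < i, t j < ε} := by
  refine (isOpen_lt continuous_const (continuous_coord i)).inter ?_
  have : {t : Simplex n | ∀ j < i, t j < (ε : ℝ)} =
      ⋂ j, ⋂ _ : j < i, {t : Simplex n | t j < (ε : ℝ)} := by
    ext t; simp
  have h2 : IsOpen {t : Simplex n | ∀ j < i, t j < (ε : ℝ)} := by
    rw [this]
    exact isOpen_iInter_of_finite fun j => isOpen_iInter_of_finite fun _ =>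
      isOpen_lt (continuous_coord j) continuous_const
  exact h2

theorem isOpen_chartSet (ε : ℝ≥0) : IsOpen (chartSet X ε) := by
  rw [← isQuotientMap_proj.isOpen_preimage, isOpen_sigma_iff]
  intro n
  by_cases hε : 0 < ε
  · have : Sigma.mk n ⁻¹' (proj ⁻¹' chartSet X ε) = ⋃ i : Fin (n + 1),
        (fun z : Kify (Simplex n × X.obj n) => z.out.1) ⁻¹' {t | ε < t i ∧ ∀ j < i, t j < ε} := by
      ext ⟨t, x⟩
      have := mk_mem_chartSet (ε := ε) (t := t) (x := x)
      simp only [mem_preimage, mem_iUnion, mem_ofPred_eq]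
      exact this.trans (and_iff_right hε)
    rw [this]
    exact isOpen_iUnion fun i => (isOpen_lead ε i).preimage Kify.continuous_out.fst
  · convert isOpen_empty
    ext ⟨t, x⟩
    exact iff_of_false (fun h => hε h.1) id

theorem exists_mem_chartSet (b : FatRealization X) : ∃ ε, b ∈ chartSet X ε := by
  induction b using ind with
  | h n t x =>
    rcases isLead_lead 0 t with ⟨h1, h2⟩ | ⟨h1, h2, -⟩
    · have h1' : (0 : ℝ) < t (lead 0 t) := by exact_mod_cast h1
      refine ⟨(⟨t (lead 0 t) / 2, by positivity⟩ : ℝ≥0), ?_, lead 0 t, ?_, ?_⟩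
      · exact NNReal.coe_pos.mp (half_pos h1')
      · exact half_lt_self h1'
      · intro j hj
        exact (h2 j hj).trans_lt (half_pos h1')
    · exact absurd (h1 _) (not_le.mpr (by exact_mod_cast h2))

/-- Evaluate a compatible family of functions at the leading vertex. -/
noncomputable def leadEval {Z : Type*} (ε : ℝ≥0)
    (f : ∀ n : ℕ, Simplex n → X.obj n → Fin (n + 1) → Z)
    (hf : ∀ ⦃m n : ℕ⦄ (θ : Fin (m + 1) ↪o Fin (n + 1)) (t : Simplex m) (x : X.obj n)
      (i : Fin (m + 1)), f m t (X.map θ x) i = f n (stdSimplex.map θ t) x (θ i)) :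
    FatRealization X → Z :=
  lift (fun n t x => f n t x (lead ε t)) (by
    intro m n θ t x
    rw [lead_map, hf])

theorem continuousOn_leadEval {Z : Type u} [TopologicalSpace Z] (ε : ℝ≥0)
    (f : ∀ n : ℕ, Simplex n → X.obj n → Fin (n + 1) → Z)
    (hf : ∀ ⦃m n : ℕ⦄ (θ : Fin (m + 1) ↪o Fin (n + 1)) (t : Simplex m) (x : X.obj n)
      (i : Fin (m + 1)), f m t (X.map θ x) i = f n (stdSimplex.map θ t) x (θ i))
    (hc : ∀ n i, Continuous fun z : Kify (Simplex n × X.obj n) => f n z.out.1 z.out.2 i) :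
    ContinuousOn (leadEval ε f hf) (chartSet X ε) := by
  refine continuousOn_of_quotient isQuotientMap_proj (isOpen_chartSet ε) ?_
  rintro ⟨n, z⟩ hz
  obtain ⟨-, i, hi⟩ : 0 < ε ∧ ∃ i : Fin (n + 1), ε < z.out.1 i ∧ ∀ j < i, z.out.1 j < ε := hz
  refine ContinuousAt.continuousWithinAt ?_
  have h1 : ContinuousAt (fun z : Kify (Simplex n × X.obj n) => f n z.out.1 z.out.2 (lead ε z.out.1))
      z := by
    refine (hc n i).continuousAt.congr ?_
    have := ((isOpen_lead ε i).preimage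
      (Kify.continuous_out (X := Simplex n × X.obj n)).fst).mem_nhds hi
    filter_upwards [this] with w hw
    congr 1
    exact ((isLead_lead ε w.out.1).unique (Or.inl ⟨hw.1, fun j hj => (hw.2 j hj).le⟩)).symm
  exact (IsOpenEmbedding.sigmaMk (σ := fun n => Kify (Simplex n × X.obj n))
    (i := n)).continuousAt_iff.mp h1

end FatRealization

end TopGpd

open TopGpd

/-! ### Topological groupoids -/

/-- A topological groupoid: a groupoid object in compactly generated spaces. Composition is written
`comp g f` (first `f`, then `g`). Its continuity, and that of every operation on a fibre product
below, is continuity for the compactly generated topology on the fibre product, i.e. continuity on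
all test maps from compact Hausdorff spaces. -/
structure TopGroupoid : Type (u + 1) where
  /-- The space of objects. -/
  Obj : Type u
  /-- The space of arrows. -/
  Arr : Type u
  [topObj : TopologicalSpace Obj]
  [topArr : TopologicalSpace Arr]
  [cgObj : CompactlyGeneratedSpace Obj]
  [cgArr : CompactlyGeneratedSpace Arr]
  /-- Source. -/
  src : Arr → Obj
  /-- Target. -/
  tgt : Arr → Obj
  /-- Identity arrows. -/
  one : Obj → Arr
  /-- Inversion. -/
  inv : Arr → Arr
  /-- Composition. -/
  comp : ∀ g f : Arr, src g = tgt f → Arr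
  continuous_src : Continuous src
  continuous_tgt : Continuous tgt
  continuous_one : Continuous one
  continuous_inv : Continuous inv
  continuous_comp : ∀ (K : Type u) [TopologicalSpace K] [CompactSpace K] [T2Space K]
    (g f : K → Arr) (h : ∀ k, src (g k) = tgt (f k)), Continuous g → Continuous f →
    Continuous fun k => comp (g k) (f k) (h k)
  src_one : ∀ x, src (one x) = x
  tgt_one : ∀ x, tgt (one x) = x
  src_inv : ∀ f, src (inv f) = tgt f
  tgt_inv : ∀ f, tgt (inv f) = src f
  src_comp : ∀ g f h, src (comp g f h) = src f
  tgt_comp : ∀ g f h, tgt (comp g f h) = tgt g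
  comp_one : ∀ f, comp f (one (src f)) (tgt_one _).symm = f
  one_comp : ∀ f, comp (one (tgt f)) f (src_one _) = f
  comp_inv : ∀ f, comp f (inv f) (tgt_inv f).symm = one (tgt f)
  inv_comp : ∀ f, comp (inv f) f (src_inv f) = one (src f)
  assoc : ∀ (k g f : Arr) (h : src k = tgt g) (h' : src g = tgt f),
    comp (comp k g h) f ((src_comp _ _ _).trans h') = comp k (comp g f h') (h.trans (tgt_comp _ _ _).symm)

attribute [instance] TopGroupoid.topObj TopGroupoid.topArr TopGroupoid.cgObj TopGroupoid.cgArr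
attribute [simp] TopGroupoid.src_one TopGroupoid.tgt_one TopGroupoid.src_inv TopGroupoid.tgt_inv
  TopGroupoid.src_comp TopGroupoid.tgt_comp

/-- A homomorphism of topological groupoids: a continuous functor. -/
@[ext]
structure TopGroupoid.Hom (H G : TopGroupoid.{u}) : Type u where
  /-- The map on objects. -/
  obj : H.Obj → G.Obj
  /-- The map on arrows. -/
  arr : H.Arr → G.Arr
  continuous_obj : Continuous obj
  continuous_arr : Continuous arr
  src_arr : ∀ f, G.src (arr f) = obj (H.src f)
  tgt_arr : ∀ f, G.tgt (arr f) = obj (H.tgt f)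
  arr_one : ∀ x, arr (H.one x) = G.one (obj x)
  arr_comp : ∀ g f (h : H.src g = H.tgt f), arr (H.comp g f h) =
    G.comp (arr g) (arr f) ((src_arr g).trans ((congrArg obj h).trans (tgt_arr f).symm))

attribute [simp] TopGroupoid.Hom.src_arr TopGroupoid.Hom.tgt_arr TopGroupoid.Hom.arr_one

namespace TopGroupoid

section Algebra

variable (G : TopGroupoid.{u})

theorem comp_congr {g g' f f' : G.Arr} (hg : g = g') (hf : f = f') (h : G.src g = G.tgt f) :
    G.comp g f h = G.comp g' f' (by rw [← hg, ← hf]; exact h) := by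
  subst hg hf; rfl

theorem comp_one' {f : G.Arr} {x : G.Obj} (h : G.src f = G.tgt (G.one x)) :
    G.comp f (G.one x) h = f := by
  have : x = G.src f := by rw [h, G.tgt_one]
  subst this
  exact G.comp_one f

theorem one_comp' {f : G.Arr} {x : G.Obj} (h : G.src (G.one x) = G.tgt f) :
    G.comp (G.one x) f h = f := by
  have : x = G.tgt f := by rw [← h, G.src_one]
  subst this
  exact G.one_comp f

theorem assoc' {k g f : G.Arr} (h : G.src k = G.tgt g) (h' : G.src (G.comp k g h) = G.tgt f) :
    G.comp (G.comp k g h) f h' = G.comp k (G.comp g f ((G.src_comp _ _ h).symm.trans h'))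
      (h.trans (G.tgt_comp _ _ _).symm) :=
  G.assoc k g f h _

theorem inv_comp_cancel {g f : G.Arr} (h : G.src g = G.tgt f)
    (h' : G.src (G.inv g) = G.tgt (G.comp g f h)) : G.comp (G.inv g) (G.comp g f h) h' = f := by
  rw [← G.assoc _ _ _ (G.src_inv g) h, G.comp_congr (G.inv_comp g) rfl, G.one_comp']

theorem comp_inv_cancel {g f : G.Arr} (h : G.src (G.inv g) = G.tgt f)
    (h' : G.src g = G.tgt (G.comp (G.inv g) f h)) : G.comp g (G.comp (G.inv g) f h) h' = f := by
  rw [← G.assoc _ _ _ (G.tgt_inv g).symm h, G.comp_congr (G.comp_inv g) rfl, G.one_comp']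

theorem comp_left_cancel {g f f' : G.Arr} (h : G.src g = G.tgt f) (h' : G.src g = G.tgt f')
    (e : G.comp g f h = G.comp g f' h') : f = f' := by
  have h1 : G.src (G.inv g) = G.tgt (G.comp g f h) := by simp
  rw [← G.inv_comp_cancel h h1, G.comp_congr rfl e, G.inv_comp_cancel]

theorem eq_inv {g f : G.Arr} (h : G.src g = G.tgt f) {x : G.Obj} (e : G.comp g f h = G.one x) :
    f = G.inv g := by
  refine G.comp_left_cancel h (G.tgt_inv g).symm ?_
  rw [e, G.comp_inv]
  congr 1
  rw [← G.tgt_one x, ← e, G.tgt_comp]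

theorem inv_inv (f : G.Arr) : G.inv (G.inv f) = f :=
  (G.eq_inv (G.src_inv f) (G.inv_comp f)).symm

theorem inv_comp_rev {g f : G.Arr} (h : G.src g = G.tgt f) :
    G.inv (G.comp g f h) = G.comp (G.inv f) (G.inv g) (by simp [h]) := by
  refine (G.eq_inv (x := G.tgt g) (by simp) ?_).symm
  rw [G.assoc', G.comp_congr (g' := g) rfl (G.comp_inv_cancel _ _), G.comp_inv]

end Algebra

namespace Hom

variable {G H K : TopGroupoid.{u}}

theorem arr_inv (F : Hom H G) (f : H.Arr) : F.arr (H.inv f) = G.inv (F.arr f) := by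
  refine G.eq_inv (x := F.obj (H.tgt f)) (by simp) ?_
  rw [← F.arr_comp _ _ (H.tgt_inv f).symm, H.comp_inv, F.arr_one]

/-- The identity functor. -/
def id (G : TopGroupoid.{u}) : Hom G G where
  obj x := x
  arr f := f
  continuous_obj := continuous_id
  continuous_arr := continuous_id
  src_arr _ := rfl
  tgt_arr _ := rfl
  arr_one _ := rfl
  arr_comp _ _ _ := rfl

/-- Composition of functors, in the order of the diagram `H → G → K`. -/
def trans (F : Hom H G) (F' : Hom G K) : Hom H K where
  obj x := F'.obj (F.obj x)
  arr f := F'.arr (F.arr f)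
  continuous_obj := F'.continuous_obj.comp F.continuous_obj
  continuous_arr := F'.continuous_arr.comp F.continuous_arr
  src_arr _ := by simp
  tgt_arr _ := by simp
  arr_one _ := by simp
  arr_comp g f h := by simp only [F.arr_comp _ _ h, F'.arr_comp]

end Hom

end TopGroupoid

/-! ### Nerve, translation groupoid and the universal bundle -/

namespace TopGpd

/-- A natural family of continuous maps induces a map of fat realizations. -/
def FatRealization.map {X Y : SemiSimplicialSpace.{u}} (f : ∀ n, X.obj n → Y.obj n)
    (hf : ∀ ⦃m n : ℕ⦄ (θ : Fin (m + 1) ↪o Fin (n + 1)) (x : X.obj n),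
      f m (X.map θ x) = Y.map θ (f n x)) : FatRealization X → FatRealization Y :=
  FatRealization.lift (fun n t x => FatRealization.mk t (f n x)) (by
    intro m n θ t x
    rw [hf, FatRealization.glue])

theorem FatRealization.continuous_map {X Y : SemiSimplicialSpace.{u}} (f : ∀ n, X.obj n → Y.obj n)
    (hf : ∀ ⦃m n : ℕ⦄ (θ : Fin (m + 1) ↪o Fin (n + 1)) (x : X.obj n),
      f m (X.map θ x) = Y.map θ (f n x)) (hc : ∀ n, Continuous (f n)) :
    Continuous (FatRealization.map f hf) := by
  refine FatRealization.continuous_lift fun n => ?_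
  refine continuous_from_compactlyGeneratedSpace _ fun K _ _ _ a ha => ?_
  exact FatRealization.continuous_mk_comp (Kify.continuous_out.comp ha).fst
    ((hc n).comp (Kify.continuous_out.comp ha).snd)

end TopGpd

namespace TopGroupoid

/-- An `n`-simplex of the nerve: objects `x₀, …, xₙ` and arrows `g i j : x_i ⟶ x_j` such that
`g j k ∘ g i j = g i k`. Such a family is the same as the string of composable arrows
`x₀ ⟶ x₁ ⟶ ⋯ ⟶ xₙ`. -/
def NerveSimplex (K : TopGroupoid.{u}) (n : ℕ) : Type u :=
  {a : (Fin (n + 1) → K.Obj) × (Fin (n + 1) → Fin (n + 1) → K.Arr) //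
    ∃ h : ∀ i j, K.src (a.2 i j) = a.1 i ∧ K.tgt (a.2 i j) = a.1 j,
      ∀ i j k, K.comp (a.2 j k) (a.2 i j) ((h j k).1.trans (h i j).2.symm) = a.2 i k}

namespace NerveSimplex

variable {K K' : TopGroupoid.{u}} {n : ℕ}

instance : TopologicalSpace (NerveSimplex K n) := instTopologicalSpaceSubtype

/-- The vertices. -/
def vert (a : NerveSimplex K n) (i : Fin (n + 1)) : K.Obj := a.1.1 i

/-- The edges. -/
def edge (a : NerveSimplex K n) (i j : Fin (n + 1)) : K.Arr := a.1.2 i j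

@[simp] theorem src_edge (a : NerveSimplex K n) (i j : Fin (n + 1)) :
    K.src (a.edge i j) = a.vert i := (a.2.choose i j).1

@[simp] theorem tgt_edge (a : NerveSimplex K n) (i j : Fin (n + 1)) :
    K.tgt (a.edge i j) = a.vert j := (a.2.choose i j).2

theorem comp_edge (a : NerveSimplex K n) (i j k : Fin (n + 1))
    (h : K.src (a.edge j k) = K.tgt (a.edge i j)) :
    K.comp (a.edge j k) (a.edge i j) h = a.edge i k := a.2.choose_spec i j k

theorem edge_self (a : NerveSimplex K n) (i : Fin (n + 1)) : a.edge i i = K.one (a.vert i) := by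
  refine K.comp_left_cancel (g := a.edge i i) (by simp) (by simp) ?_
  rw [comp_edge, comp_one']

/-- Constructor. -/
def of (v : Fin (n + 1) → K.Obj) (e : Fin (n + 1) → Fin (n + 1) → K.Arr)
    (hs : ∀ i j, K.src (e i j) = v i) (ht : ∀ i j, K.tgt (e i j) = v j)
    (hc : ∀ i j k, K.comp (e j k) (e i j) ((hs j k).trans (ht i j).symm) = e i k) :
    NerveSimplex K n :=
  ⟨(v, e), fun i j => ⟨hs i j, ht i j⟩, hc⟩

theorem ext' {a b : NerveSimplex K n} (hv : ∀ i, a.vert i = b.vert i)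
    (he : ∀ i j, a.edge i j = b.edge i j) : a = b :=
  Subtype.ext (Prod.ext (funext hv) (funext fun i => funext (he i)))

theorem continuous_vert (i : Fin (n + 1)) : Continuous fun a : NerveSimplex K n => a.vert i :=
  (continuous_apply i).comp (continuous_fst.comp continuous_subtype_val)

theorem continuous_edge (i j : Fin (n + 1)) :
    Continuous fun a : NerveSimplex K n => a.edge i j :=
  (continuous_apply j).comp ((continuous_apply i).comp (continuous_snd.comp continuous_subtype_val))

theorem continuous_iff {Z : Type*} [TopologicalSpace Z] {f : Z → NerveSimplex K n}
    (hv : ∀ i, Continuous fun z => (f z).vert i) (he : ∀ i j, Continuous fun z => (f z).edge i j) :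
    Continuous f :=
  Continuous.subtype_mk ((continuous_pi hv).prodMk
    (continuous_pi fun i => continuous_pi fun j => he i j)) fun z => (f z).2

/-- Restriction along a map of index sets. -/
def restrict {m : ℕ} (θ : Fin (m + 1) → Fin (n + 1)) (a : NerveSimplex K n) : NerveSimplex K m :=
  of (fun i => a.vert (θ i)) (fun i j => a.edge (θ i) (θ j)) (fun _ _ => a.src_edge _ _)
    (fun _ _ => a.tgt_edge _ _) (fun _ _ _ => a.comp_edge _ _ _ _)

/-- The map of nerves induced by a functor. -/
def map (F : Hom K K') (a : NerveSimplex K n) : NerveSimplex K' n :=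
  of (fun i => F.obj (a.vert i)) (fun i j => F.arr (a.edge i j)) (by simp) (by simp)
    (fun i j k => by rw [← F.arr_comp _ _ (by simp), a.comp_edge])

end NerveSimplex

/-- The nerve of a topological groupoid. -/
def nerve (K : TopGroupoid.{u}) : SemiSimplicialSpace.{u} where
  obj n := Kify (NerveSimplex K n)
  map θ a := ⟨a.out.restrict θ⟩
  continuous_map θ := Kify.continuous_mk_comp fun _ _ _ _ _ ha =>
    NerveSimplex.continuous_iff
      (fun i => (NerveSimplex.continuous_vert (θ i)).comp (Kify.continuous_out.comp ha))
      (fun i j => (NerveSimplex.continuous_edge (θ i) (θ j)).comp (Kify.continuous_out.comp ha))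
  map_id _ := rfl
  map_comp _ _ _ := rfl

/-- The fat realization of the nerve, `‖K‖`. -/
abbrev Realization (K : TopGroupoid.{u}) : Type u := FatRealization (nerve K)

/-- The point of `‖K‖` given by a point of `Δⁿ` and an `n`-simplex of the nerve. -/
def Realization.mk {K : TopGroupoid.{u}} {n : ℕ} (t : Simplex n) (a : NerveSimplex K n) :
    Realization K :=
  FatRealization.mk (X := nerve K) t ⟨a⟩

theorem Realization.ind {K : TopGroupoid.{u}} {p : Realization K → Prop}
    (h : ∀ {n : ℕ} (t : Simplex n) (a : NerveSimplex K n), p (mk t a)) (b : Realization K) : p b := by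
  induction b using FatRealization.ind with
  | h n t a => exact h t a.out

theorem Realization.glue {K : TopGroupoid.{u}} {m n : ℕ} (θ : Fin (m + 1) ↪o Fin (n + 1))
    (t : Simplex m) (a : NerveSimplex K n) :
    mk t (a.restrict θ) = mk (stdSimplex.map θ t) a :=
  FatRealization.glue (X := nerve K) θ t ⟨a⟩

theorem Realization.mk_congr {K : TopGroupoid.{u}} {n : ℕ} {t : Simplex n} {a b : NerveSimplex K n}
    (hv : ∀ i, a.vert i = b.vert i) (he : ∀ i j, a.edge i j = b.edge i j) : mk t a = mk t b :=
  congrArg (mk t) (NerveSimplex.ext' hv he)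

/-- Descend a function to `‖K‖`. -/
def Realization.lift {K : TopGroupoid.{u}} {Z : Type*}
    (f : ∀ n : ℕ, Simplex n → NerveSimplex K n → Z)
    (hf : ∀ ⦃m n : ℕ⦄ (θ : Fin (m + 1) ↪o Fin (n + 1)) (t : Simplex m) (x : NerveSimplex K n),
      f m t (x.restrict θ) = f n (stdSimplex.map θ t) x) : Realization K → Z :=
  FatRealization.lift (X := nerve K) (fun n t a => f n t (Kify.out a))
    (fun _ _ θ t x => hf θ t (Kify.out x))

theorem Realization.continuous_lift {K : TopGroupoid.{u}} {Z : Type u} [TopologicalSpace Z]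
    (f : ∀ n : ℕ, Simplex n → NerveSimplex K n → Z)
    (hf : ∀ ⦃m n : ℕ⦄ (θ : Fin (m + 1) ↪o Fin (n + 1)) (t : Simplex m) (x : NerveSimplex K n),
      f m t (x.restrict θ) = f n (stdSimplex.map θ t) x)
    (hc : ∀ n, Continuous fun z : Simplex n × NerveSimplex K n => f n z.1 z.2) :
    Continuous (lift f hf) :=
  FatRealization.continuous_lift (X := nerve K) fun n => (hc n).comp
    (Kify.continuous_out.fst.prodMk (Kify.continuous_out.comp Kify.continuous_out.snd))

/-- The map `‖K‖ → ‖K'‖` induced by a functor. -/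
def Realization.map {K K' : TopGroupoid.{u}} (F : Hom K K') : Realization K → Realization K' :=
  FatRealization.map (X := nerve K) (Y := nerve K') (fun _ a => ⟨a.out.map F⟩)
    (fun _ _ _ _ => rfl)

theorem Realization.continuous_map {K K' : TopGroupoid.{u}} (F : Hom K K') :
    Continuous (Realization.map F) :=
  FatRealization.continuous_map _ _ fun _ => Kify.continuous_mk_comp fun _ _ _ _ _ ha =>
    NerveSimplex.continuous_iff
      (fun i => F.continuous_obj.comp
        ((NerveSimplex.continuous_vert i).comp (Kify.continuous_out.comp ha)))
      (fun i j => F.continuous_arr.comp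
        ((NerveSimplex.continuous_edge i j).comp (Kify.continuous_out.comp ha)))

variable (G : TopGroupoid.{u})

/-- The translation groupoid `𝔼G = G ⋉ G₁`, the action groupoid of the left translation action of
`G` on the space `G₁` over `G₀` (by the target map): its objects are the arrows `x` of `G`, its
arrows are the composable pairs `(g, x)`, regarded as an arrow from `x` to `g ∘ x`. -/
def translation : TopGroupoid.{u} where
  Obj := G.Arr
  Arr := Kify {p : G.Arr × G.Arr // G.src p.1 = G.tgt p.2}
  src p := p.out.1.2
  tgt p := G.comp p.out.1.1 p.out.1.2 p.out.2
  one x := ⟨⟨(G.one (G.tgt x), x), by simp⟩⟩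
  inv p := ⟨⟨(G.inv p.out.1.1, G.comp p.out.1.1 p.out.1.2 p.out.2), by simp⟩⟩
  comp q p h := ⟨⟨(G.comp q.out.1.1 p.out.1.1 (by rw [q.out.2, h, G.tgt_comp]), p.out.1.2), by
    simp [p.out.2]⟩⟩
  continuous_src := (continuous_subtype_val.comp Kify.continuous_out).snd
  continuous_tgt := continuous_from_compactlyGeneratedSpace _ fun K _ _ _ a ha =>
    G.continuous_comp K _ _ _ (continuous_subtype_val.comp (Kify.continuous_out.comp ha)).fst
      (continuous_subtype_val.comp (Kify.continuous_out.comp ha)).snd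
  continuous_one := Kify.continuous_mk_comp fun K _ _ _ a ha =>
    ((G.continuous_one.comp (G.continuous_tgt.comp ha)).prodMk ha).subtype_mk _
  continuous_inv := Kify.continuous_mk_comp fun K _ _ _ a ha =>
    ((G.continuous_inv.comp (continuous_subtype_val.comp (Kify.continuous_out.comp ha)).fst).prodMk
      (G.continuous_comp K _ _ _ (continuous_subtype_val.comp (Kify.continuous_out.comp ha)).fst
        (continuous_subtype_val.comp (Kify.continuous_out.comp ha)).snd)).subtype_mk _
  continuous_comp K _ _ _ q p h hq hp := Kify.continuous_comp_mk
    (((G.continuous_comp K _ _ _ (continuous_subtype_val.comp (Kify.continuous_out.comp hq)).fst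
      (continuous_subtype_val.comp (Kify.continuous_out.comp hp)).fst).prodMk
        (continuous_subtype_val.comp (Kify.continuous_out.comp hp)).snd).subtype_mk _)
  src_one _ := rfl
  tgt_one x := G.one_comp x
  src_inv _ := rfl
  tgt_inv p := G.inv_comp_cancel p.out.2 _
  src_comp _ _ _ := rfl
  tgt_comp q p h := by
    rw [G.assoc']
    exact G.comp_congr rfl h.symm _
  comp_one p := Kify.ext (Subtype.ext (Prod.ext (G.comp_one' _) rfl))
  one_comp p := Kify.ext (Subtype.ext (Prod.ext (G.one_comp' _) rfl))
  comp_inv p := Kify.ext (Subtype.ext (Prod.ext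
    ((G.comp_inv _).trans (congrArg G.one (G.tgt_comp _ _ _).symm)) rfl))
  inv_comp p := Kify.ext (Subtype.ext (Prod.ext
    ((G.inv_comp _).trans (congrArg G.one p.out.2)) rfl))
  assoc k g f h h' := Kify.ext (Subtype.ext (Prod.ext (G.assoc _ _ _ _ _) rfl))

/-- The projection functor `𝔼G → G`, `x ↦ tgt x`, `(g, x) ↦ g`. -/
def translationProj : Hom (translation G) G where
  obj x := G.tgt x
  arr p := p.out.1.1
  continuous_obj := G.continuous_tgt
  continuous_arr := (continuous_subtype_val.comp Kify.continuous_out).fst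
  src_arr p := p.out.2
  tgt_arr _ := (G.tgt_comp _ _ _).symm
  arr_one _ := rfl
  arr_comp _ _ _ := rfl

variable {G} in
/-- The functor `𝔼G → 𝔼G'` induced by a functor `G → G'`. -/
def translationMap {G' : TopGroupoid.{u}} (ψ : Hom G G') : Hom (translation G) (translation G') where
  obj x := ψ.arr x
  arr p := ⟨⟨(ψ.arr p.out.1.1, ψ.arr p.out.1.2), by simp [p.out.2]⟩⟩
  continuous_obj := ψ.continuous_arr
  continuous_arr := Kify.continuous_mk_comp fun K _ _ _ a ha =>
    ((ψ.continuous_arr.comp (continuous_subtype_val.comp (Kify.continuous_out.comp ha)).fst).prodMk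
      (ψ.continuous_arr.comp
        (continuous_subtype_val.comp (Kify.continuous_out.comp ha)).snd)).subtype_mk _
  src_arr _ := rfl
  tgt_arr p := (ψ.arr_comp _ _ p.out.2).symm
  arr_one x := Kify.ext (Subtype.ext (Prod.ext
    ((ψ.arr_one _).trans (congrArg G'.one (ψ.tgt_arr x).symm)) rfl))
  arr_comp q p h := Kify.ext (Subtype.ext (Prod.ext (ψ.arr_comp _ _ _) rfl))

/-- The base `‖G‖` of the universal bundle. -/
abbrev UnivBase : Type u := Realization G

/-- The total space `‖𝔼G‖` of the universal bundle. -/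
abbrev UnivTotal : Type u := Realization (translation G)

namespace UnivTotal

variable {G}

/-- The bundle projection `‖𝔼G‖ → ‖G‖`. -/
def proj : UnivTotal G → UnivBase G := Realization.map (translationProj G)

theorem continuous_proj : Continuous (proj (G := G)) := Realization.continuous_map _

theorem src_vert {n : ℕ} (a : NerveSimplex (translation G) n) (i j : Fin (n + 1)) :
    G.src (a.vert i) = G.src (a.vert j) := by
  have h : G.comp _ _ _ = a.vert j := a.tgt_edge i j
  rw [← h, G.src_comp]
  exact congrArg G.src (a.src_edge i j).symm

/-- The anchor map `‖𝔼G‖ → G₀`, which sends a simplex with vertices `x_i ∈ G₁` to the common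
source of the `x_i`. -/
def anchor : UnivTotal G → G.Obj :=
  Realization.lift (fun _ _ a => G.src (a.vert 0)) (fun _ _ θ _ a => src_vert a (θ 0) 0)

theorem continuous_anchor : Continuous (anchor (G := G)) :=
  Realization.continuous_lift _ _ fun _ => G.continuous_src.comp
    ((NerveSimplex.continuous_vert 0).comp continuous_snd)

/-- Translation of a simplex with vertices `x_i` by `γ`, to the simplex with vertices
`x_i ∘ γ`. -/
def actSimplex {n : ℕ} (γ : G.Arr) (a : NerveSimplex (translation G) n)
    (h : ∀ i, G.src (a.vert i) = G.tgt γ) : NerveSimplex (translation G) n :=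
  have h' : ∀ i j, G.src (a.edge i j).out.1.2 = G.tgt γ := fun i j =>
    (congrArg G.src (a.src_edge i j)).trans (h i)
  NerveSimplex.of (K := translation G) (fun i => G.comp (a.vert i) γ (h i))
    (fun i j => ⟨⟨((a.edge i j).out.1.1, G.comp (a.edge i j).out.1.2 γ (h' i j)), by
      rw [G.tgt_comp]; exact (a.edge i j).out.2⟩⟩)
    (fun i j => G.comp_congr (a.src_edge i j) rfl _)
    (fun i j => (G.assoc _ _ _ (a.edge i j).out.2 (h' i j)).symm.trans
      (G.comp_congr (a.tgt_edge i j) rfl _))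
    (fun i j k => by
      have := a.comp_edge i j k (by simp)
      exact Kify.ext (Subtype.ext (Prod.ext (congrArg (fun p => p.out.1.1) this)
        (G.comp_congr (congrArg (fun p : (translation G).Arr => p.out.1.2) this) rfl (h' i j)))))

open Classical in
/-- The right action of `G` on `‖𝔼G‖` along the anchor map, induced by right translation
`x ↦ x ∘ γ` on `G₁` (and extended by the identity to pairs which are not composable). -/
noncomputable def act (γ : G.Arr) : UnivTotal G → UnivTotal G :=
  Realization.lift (fun _ t a =>
    if h : ∀ i, G.src (a.vert i) = G.tgt γ then Realization.mk t (actSimplex γ a h)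
    else Realization.mk t a) (by
    intro m n θ t a
    by_cases h : ∀ i, G.src (a.vert i) = G.tgt γ
    · rw [dif_pos h, dif_pos (show ∀ i, G.src ((a.restrict θ).vert i) = G.tgt γ from
        fun i => h (θ i))]
      exact Realization.glue θ t (actSimplex γ a h)
    · rw [dif_neg h, dif_neg]
      · exact Realization.glue θ t a
      · exact fun h' => h fun i => (src_vert a i (θ 0)).trans (h' 0))

theorem act_mk {n : ℕ} {γ : G.Arr} {t : Simplex n} {a : NerveSimplex (translation G) n}
    (h : ∀ i, G.src (a.vert i) = G.tgt γ) :
    act γ (Realization.mk t a) =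
      Realization.mk t (actSimplex γ a h) := dif_pos h

theorem forall_src_vert {n : ℕ} {γ : G.Arr} {t : Simplex n} {a : NerveSimplex (translation G) n}
    (h : anchor (Realization.mk t a) = G.tgt γ) (i : Fin (n + 1)) :
    G.src (a.vert i) = G.tgt γ :=
  (src_vert a i 0).trans h

theorem anchor_act {γ : G.Arr} {e : UnivTotal G} (h : anchor e = G.tgt γ) :
    anchor (act γ e) = G.src γ := by
  induction e using Realization.ind with
  | h t a =>
    rw [act_mk (forall_src_vert h)]
    exact G.src_comp _ _ _

theorem proj_act {γ : G.Arr} {e : UnivTotal G} (h : anchor e = G.tgt γ) :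
    proj (act γ e) = proj e := by
  induction e using Realization.ind with
  | h t a =>
    rw [act_mk (forall_src_vert h)]
    exact Realization.mk_congr (fun i => G.tgt_comp _ _ _) fun i j => rfl

theorem act_one {x : G.Obj} {e : UnivTotal G} (h : anchor e = x) : act (G.one x) e = e := by
  induction e using Realization.ind with
  | h t a =>
    rw [act_mk (forall_src_vert (h.trans (G.tgt_one x).symm))]
    exact Realization.mk_congr (fun i => G.comp_one' _) fun i j =>
      Kify.ext (Subtype.ext (Prod.ext rfl (G.comp_one' _)))

theorem act_act {γ δ : G.Arr} {e : UnivTotal G} (h : anchor e = G.tgt δ) (h' : G.src δ = G.tgt γ) :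
    act γ (act δ e) = act (G.comp δ γ h') e := by
  induction e using Realization.ind with
  | h t a =>
    rw [act_mk (forall_src_vert h), act_mk (fun i => (G.src_comp _ _ _).trans h'),
      act_mk (forall_src_vert (h.trans (G.tgt_comp _ _ _).symm))]
    exact Realization.mk_congr (fun i => G.assoc _ _ _ _ _) fun i j =>
      Kify.ext (Subtype.ext (Prod.ext rfl (G.assoc _ _ _ _ _)))

theorem continuous_act [WeaklyHausdorff G.Obj] (K : Type u) [TopologicalSpace K] [CompactSpace K]
    [T2Space K] (γ : K → G.Arr) (e : K → UnivTotal G) (hγ : Continuous γ) (he : Continuous e)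
    (h : ∀ k, anchor (e k) = G.tgt (γ k)) : Continuous fun k => act (γ k) (e k) := by
  refine continuous_of_quotient_fibreProduct FatRealization.isQuotientMap_proj continuous_anchor
    G.continuous_tgt (fun e γ => act γ e) ?_ K e γ he hγ h
  intro L _ _ _ z y hz hy hzy
  refine continuous_iff_continuousAt.mpr fun l => ?_
  have hV : z ⁻¹' (Sigma.mk (z l).1 '' univ) ∈ 𝓝 l :=
    (((isOpenMap_sigmaMk _ isOpen_univ).preimage hz).mem_nhds ⟨(z l).2, trivial, rfl⟩)
  refine continuousAt_of_test hV fun N _ hN => ?_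
  generalize (z l).1 = n at hN
  have hN' : ∀ k : N, ∃ w : Kify (Simplex n × (nerve (translation G)).obj n), ⟨n, w⟩ = z k :=
    fun k => by
      obtain ⟨w, -, hw⟩ := hN k.2
      exact ⟨w, hw⟩
  choose w hw using hN'
  have hwc : Continuous w := by
    rw [(Topology.IsOpenEmbedding.sigmaMk
      (σ := fun n => Kify (Simplex n × (nerve (translation G)).obj n))
      (i := n)).isInducing.continuous_iff]
    exact (hz.comp continuous_subtype_val).congr fun k => (hw k).symm
  have hsrc : ∀ (k : N) i, G.src (NerveSimplex.vert (w k).out.2.out i) = G.tgt (y k) := by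
    intro k
    have := hzy k
    rw [← hw k] at this
    exact forall_src_vert this
  have hac : Continuous fun k : N => (w k).out.2.out :=
    Kify.continuous_out.comp (Kify.continuous_out.comp hwc).snd
  have : Continuous fun k : N => Realization.mk (w k).out.1
      (actSimplex (y k) (w k).out.2.out (hsrc k)) := by
    refine FatRealization.continuous_mk_comp (X := nerve (translation G))
      (Kify.continuous_out.comp hwc).fst (Kify.continuous_comp_mk
        (NerveSimplex.continuous_iff (fun i => ?_) fun i j => Kify.continuous_comp_mk ?_))
    · exact G.continuous_comp N _ _ _ ((NerveSimplex.continuous_vert i).comp hac)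
        (hy.comp continuous_subtype_val)
    · have h3 := continuous_subtype_val.comp
        (Kify.continuous_out.comp ((NerveSimplex.continuous_edge i j).comp hac))
      exact (h3.fst.prodMk (G.continuous_comp N _ _ _ h3.snd
        (hy.comp continuous_subtype_val))).subtype_mk _
  refine this.congr fun k => ?_
  rw [← act_mk (hsrc k), ← hw k]
  rfl

/-! Local trivializations of the universal bundle. -/

open scoped NNReal

/-- The leading vertex, as an element of `G₁`. -/
noncomputable def chart (ε : ℝ≥0) : UnivTotal G → G.Arr :=
  FatRealization.leadEval (X := nerve (translation G)) ε
    (fun _ _ a i => NerveSimplex.vert (Kify.out a) i) (fun _ _ _ _ _ _ => rfl)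

/-- The leading vertex of a point of the base. -/
noncomputable def baseVert (ε : ℝ≥0) : UnivBase G → G.Obj :=
  FatRealization.leadEval (X := nerve G) ε
    (fun _ _ a i => NerveSimplex.vert (Kify.out a) i) (fun _ _ _ _ _ _ => rfl)

/-- The lift of a simplex given by its `i`-th vertex. -/
def secSimplex {n : ℕ} (a : NerveSimplex G n) (i : Fin (n + 1)) : NerveSimplex (translation G) n :=
  NerveSimplex.of (K := translation G) (fun j => a.edge i j)
    (fun j k => ⟨⟨(a.edge j k, a.edge i j), by simp⟩⟩) (fun _ _ => rfl)
    (fun j k => a.comp_edge i j k _)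
    (fun j k l => Kify.ext (Subtype.ext (Prod.ext (a.comp_edge j k l _) rfl)))

/-- A section of the universal bundle, continuous on `chartSet _ ε`. -/
noncomputable def sec (ε : ℝ≥0) : UnivBase G → UnivTotal G :=
  FatRealization.leadEval (X := nerve G) ε
    (fun _ t a i => Realization.mk t (secSimplex (Kify.out a) i))
    (fun _ _ θ t a i => FatRealization.glue (X := nerve (translation G)) θ t
      ⟨secSimplex (Kify.out a) (θ i)⟩)

theorem continuousOn_chart (ε : ℝ≥0) :
    ContinuousOn (chart (G := G) ε) (FatRealization.chartSet (nerve (translation G)) ε) :=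
  FatRealization.continuousOn_leadEval ε _ _ fun _ i =>
    (NerveSimplex.continuous_vert i).comp (Kify.continuous_out.comp Kify.continuous_out.snd)

theorem proj_mem_chartSet {ε : ℝ≥0} {e : UnivTotal G} :
    proj e ∈ FatRealization.chartSet (nerve G) ε ↔
      e ∈ FatRealization.chartSet (nerve (translation G)) ε := by
  induction e using Realization.ind with
  | h t a => rfl

theorem continuousOn_sec (ε : ℝ≥0) :
    ContinuousOn (sec (G := G) ε) (FatRealization.chartSet (nerve G) ε) := by
  refine FatRealization.continuousOn_leadEval ε _ _ fun n i => ?_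
  refine continuous_from_compactlyGeneratedSpace _ fun K _ _ _ a ha => ?_
  have hac : Continuous fun k => (a k).out.2.out :=
    Kify.continuous_out.comp (Kify.continuous_out.comp ha).snd
  exact FatRealization.continuous_mk_comp (X := nerve (translation G))
    (Kify.continuous_out.comp ha).fst (Kify.continuous_comp_mk (NerveSimplex.continuous_iff
      (fun j => (NerveSimplex.continuous_edge i j).comp hac) fun j k => Kify.continuous_comp_mk
        ((((NerveSimplex.continuous_edge j k).comp hac).prodMk
          ((NerveSimplex.continuous_edge i j).comp hac)).subtype_mk _)))

@[simp] theorem proj_sec (ε : ℝ≥0) (b : UnivBase G) : proj (sec ε b) = b := by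
  induction b using Realization.ind with
  | h t a => exact Realization.mk_congr (fun i => a.tgt_edge _ _) fun i j => rfl

theorem chart_sec (ε : ℝ≥0) (b : UnivBase G) : chart ε (sec ε b) = G.one (baseVert ε b) := by
  induction b using Realization.ind with
  | h t a => exact a.edge_self _

@[simp] theorem anchor_sec (ε : ℝ≥0) (b : UnivBase G) : anchor (sec ε b) = baseVert ε b := by
  induction b using Realization.ind with
  | h t a => exact a.src_edge _ _

@[simp] theorem tgt_chart (ε : ℝ≥0) (e : UnivTotal G) :
    G.tgt (chart ε e) = baseVert ε (proj e) := by
  induction e using Realization.ind with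
  | h t a => rfl

@[simp] theorem src_chart (ε : ℝ≥0) (e : UnivTotal G) : G.src (chart ε e) = anchor e := by
  induction e using Realization.ind with
  | h t a => exact src_vert _ _ _

theorem chart_act (ε : ℝ≥0) {γ : G.Arr} {e : UnivTotal G} (h : anchor e = G.tgt γ) :
    chart ε (act γ e) = G.comp (chart ε e) γ ((src_chart ε e).trans h) := by
  induction e using Realization.ind with
  | h t a =>
    rw [act_mk (forall_src_vert h)]
    rfl

theorem act_chart (ε : ℝ≥0) (e : UnivTotal G) : act (chart ε e) (sec ε (proj e)) = e := by
  induction e using Realization.ind with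
  | h t a =>
    have key : ∀ i j, G.comp (a.edge i j).out.1.1 (a.vert i)
        ((a.edge i j).out.2.trans (congrArg G.tgt (a.src_edge i j))) = a.vert j :=
      fun i j => (G.comp_congr rfl (a.src_edge i j).symm _).trans (a.tgt_edge i j)
    have hs : ∀ i, G.src ((secSimplex (a.map (translationProj G)) (FatRealization.lead ε t)).vert i) =
        G.tgt (a.vert (FatRealization.lead ε t)) := fun i =>
      NerveSimplex.src_edge (a.map (translationProj G)) _ _
    refine (act_mk (t := t) hs).trans (Realization.mk_congr (fun i => key _ i) fun i j =>
        Kify.ext (Subtype.ext (Prod.ext rfl ?_)))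
    exact (key _ i).trans (NerveSimplex.src_edge a i j).symm

end UnivTotal

end TopGroupoid

/-! ### The fibrant replacement -/

namespace TopGroupoid

open scoped NNReal

/-- The fibre product `‖𝔼G‖ ×_{G₀} ‖𝔼G‖`. -/
abbrev UnivPairs (G : TopGroupoid.{u}) : Type u :=
  Kify {p : UnivTotal G × UnivTotal G // UnivTotal.anchor p.1 = UnivTotal.anchor p.2}

/-- The orbit relation of the diagonal action of `G` on `‖𝔼G‖ ×_{G₀} ‖𝔼G‖`. -/
def OrbitRel (G : TopGroupoid.{u}) (p q : UnivPairs G) : Prop :=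
  ∃ γ : G.Arr, UnivTotal.anchor p.out.1.1 = G.tgt γ ∧
    q.out.1.1 = UnivTotal.act γ p.out.1.1 ∧ q.out.1.2 = UnivTotal.act γ p.out.1.2

/-- The arrow space `(‖𝔼G‖ ×_{G₀} ‖𝔼G‖) / G` of the gauge groupoid of the universal bundle, with
the quotient topology. -/
def FibArr (G : TopGroupoid.{u}) : Type u := Quot (OrbitRel G)

namespace FibArr

open UnivTotal

variable {G : TopGroupoid.{u}}

instance : TopologicalSpace (FibArr G) := inferInstanceAs (TopologicalSpace (Quot (OrbitRel G)))

/-- The class of a pair, regarded as an arrow from `proj e` to `proj e'`. -/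
def mk (e e' : UnivTotal G) (h : anchor e = anchor e') : FibArr G := Quot.mk _ ⟨⟨(e, e'), h⟩⟩

/-- The quotient map. -/
def quot (p : UnivPairs G) : FibArr G := Quot.mk _ p

theorem isQuotientMap_quot : IsQuotientMap (quot : UnivPairs G → FibArr G) := isQuotientMap_quot_mk

instance : CompactlyGeneratedSpace (FibArr G) :=
  uCompactlyGeneratedSpace_of_coinduced (isQuotientMap_quot (G := G)).continuous
    (isQuotientMap_quot (G := G)).eq_coinduced

theorem ind {p : FibArr G → Prop} (h : ∀ e e' (w : anchor e = anchor e'), p (mk e e' w))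
    (q : FibArr G) : p q := by
  obtain ⟨⟨⟨⟨e, e'⟩, w⟩⟩⟩ := q
  exact h e e' w

theorem mk_act {e e' : UnivTotal G} (w : anchor e = anchor e') {γ : G.Arr}
    (h : anchor e = G.tgt γ) : mk (act γ e) (act γ e')
      ((anchor_act h).trans (anchor_act (w.symm.trans h)).symm) = mk e e' w :=
  (Quot.sound ⟨γ, h, rfl, rfl⟩).symm

theorem mk_congr {e e' f f' : UnivTotal G} (he : e = f) (he' : e' = f') (w : anchor e = anchor e') :
    mk e e' w = mk f f' (by rw [← he, ← he']; exact w) := by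
  subst he he'; rfl

/-- Descend a function to the arrow space. -/
def lift {Z : Type*} (f : ∀ e e' : UnivTotal G, anchor e = anchor e' → Z)
    (hf : ∀ (e e' : UnivTotal G) (w : anchor e = anchor e') (γ : G.Arr) (h : anchor e = G.tgt γ),
      f e e' w = f (act γ e) (act γ e') ((anchor_act h).trans (anchor_act (w.symm.trans h)).symm)) :
    FibArr G → Z :=
  Quot.lift (fun p => f p.out.1.1 p.out.1.2 p.out.2) (by
    rintro p ⟨⟨⟨f, f'⟩, w'⟩⟩ ⟨γ, h, h1, h2⟩
    dsimp only at h1 h2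
    subst h1 h2
    exact hf _ _ _ γ h)

theorem continuousOn_lift {Z : Type u} [TopologicalSpace Z]
    (f : ∀ e e' : UnivTotal G, anchor e = anchor e' → Z)
    (hf : ∀ (e e' : UnivTotal G) (w : anchor e = anchor e') (γ : G.Arr) (h : anchor e = G.tgt γ),
      f e e' w = f (act γ e) (act γ e') ((anchor_act h).trans (anchor_act (w.symm.trans h)).symm))
    {O : Set (FibArr G)} (hO : IsOpen O)
    (hc : ∀ (K : Type u) [TopologicalSpace K] [CompactSpace K] [T2Space K] (e e' : K → UnivTotal G)
      (w : ∀ k, anchor (e k) = anchor (e' k)), Continuous e → Continuous e' →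
      (∀ k, mk (e k) (e' k) (w k) ∈ O) → Continuous fun k => f (e k) (e' k) (w k)) :
    ContinuousOn (lift f hf) O := by
  refine continuousOn_of_quotient isQuotientMap_quot hO ?_
  refine continuousOn_of_test (hO.preimage isQuotientMap_quot.continuous) fun K _ _ _ a ha hk => ?_
  have := continuous_subtype_val.comp (Kify.continuous_out.comp ha)
  exact hc K (fun k => (a k).out.1.1) (fun k => (a k).out.1.2) (fun k => (a k).out.2) this.fst
    this.snd hk

theorem continuous_lift {Z : Type u} [TopologicalSpace Z]
    (f : ∀ e e' : UnivTotal G, anchor e = anchor e' → Z)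
    (hf : ∀ (e e' : UnivTotal G) (w : anchor e = anchor e') (γ : G.Arr) (h : anchor e = G.tgt γ),
      f e e' w = f (act γ e) (act γ e') ((anchor_act h).trans (anchor_act (w.symm.trans h)).symm))
    (hc : ∀ (K : Type u) [TopologicalSpace K] [CompactSpace K] [T2Space K] (e e' : K → UnivTotal G)
      (w : ∀ k, anchor (e k) = anchor (e' k)), Continuous e → Continuous e' →
      Continuous fun k => f (e k) (e' k) (w k)) :
    Continuous (lift f hf) :=
  continuousOn_univ.mp (continuousOn_lift f hf isOpen_univ
    fun K _ _ _ e e' w he he' _ => hc K e e' w he he')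

theorem continuous_mk_comp {K : Type u} [TopologicalSpace K] [CompactSpace K] [T2Space K]
    {e e' : K → UnivTotal G} (w : ∀ k, anchor (e k) = anchor (e' k)) (he : Continuous e)
    (he' : Continuous e') : Continuous fun k => mk (e k) (e' k) (w k) :=
  isQuotientMap_quot.continuous.comp (Kify.continuous_comp_mk ((he.prodMk he').subtype_mk w))

/-- Source map. -/
def src : FibArr G → UnivBase G :=
  lift (fun e _ _ => proj e) (fun _ _ _ _ h => (proj_act h).symm)

/-- Target map. -/
def tgt : FibArr G → UnivBase G :=
  lift (fun _ e' _ => proj e') (fun _ _ w _ h => (proj_act (w.symm.trans h)).symm)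

theorem continuous_src : Continuous (src (G := G)) :=
  continuous_lift _ _ fun _ _ _ _ _ _ _ he _ => continuous_proj.comp he

theorem continuous_tgt : Continuous (tgt (G := G)) :=
  continuous_lift _ _ fun _ _ _ _ _ _ _ _ he' => continuous_proj.comp he'

/-- An arrow of the gauge groupoid in local trivializations of the universal bundle. -/
noncomputable def loc (ε δ : ℝ≥0) : FibArr G → G.Arr :=
  lift (fun e e' w => G.comp (chart δ e') (G.inv (chart ε e)) (by simp [w])) (by
    intro e e' w γ h
    have h' := w.symm.trans h
    rw [G.comp_congr (chart_act δ h') (congrArg G.inv (chart_act ε h)),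
      G.comp_congr rfl (G.inv_comp_rev _), G.assoc', G.comp_congr rfl (G.comp_inv_cancel _ _)])

@[simp] theorem src_loc (ε δ : ℝ≥0) (q : FibArr G) : G.src (loc ε δ q) = baseVert ε (src q) := by
  induction q using ind with
  | h e e' w => exact (G.src_comp _ _ _).trans ((G.src_inv _).trans (tgt_chart _ _))

@[simp] theorem tgt_loc (ε δ : ℝ≥0) (q : FibArr G) : G.tgt (loc ε δ q) = baseVert δ (tgt q) := by
  induction q using ind with
  | h e e' w => exact (G.tgt_comp _ _ _).trans (tgt_chart _ _)

theorem continuousOn_loc (ε δ : ℝ≥0) : ContinuousOn (loc (G := G) ε δ)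
    (src ⁻¹' FatRealization.chartSet (nerve G) ε ∩ tgt ⁻¹' FatRealization.chartSet (nerve G) δ) := by
  refine continuousOn_lift _ _ (((FatRealization.isOpen_chartSet ε).preimage continuous_src).inter
    ((FatRealization.isOpen_chartSet δ).preimage continuous_tgt)) ?_
  intro K _ _ _ e e' w he he' hk
  refine G.continuous_comp K _ _ _ ?_ (G.continuous_inv.comp ?_)
  · exact (continuousOn_chart δ).comp_continuous he' fun k => proj_mem_chartSet.mp (hk k).2
  · exact (continuousOn_chart ε).comp_continuous he fun k => proj_mem_chartSet.mp (hk k).1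

theorem anchor_act_sec {δ : ℝ≥0} {b' : UnivBase G} {γ : G.Arr} (ht : G.tgt γ = baseVert δ b') :
    anchor (act γ (sec δ b')) = G.src γ := anchor_act (by simp [ht])

/-- The arrow with given source and target and given local expression. -/
noncomputable def ofLoc (ε δ : ℝ≥0) (b b' : UnivBase G) (γ : G.Arr) (hs : G.src γ = baseVert ε b)
    (ht : G.tgt γ = baseVert δ b') : FibArr G :=
  mk (sec ε b) (act γ (sec δ b')) (by rw [anchor_sec, anchor_act_sec ht, hs])

theorem ofLoc_congr {ε δ : ℝ≥0} {b b' c c' : UnivBase G} {γ γ' : G.Arr} (hb : b = c) (hb' : b' = c')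
    (hγ : γ = γ') (hs : G.src γ = baseVert ε b) (ht : G.tgt γ = baseVert δ b') :
    ofLoc ε δ b b' γ hs ht = ofLoc ε δ c c' γ' (by rw [← hγ, ← hb]; exact hs)
      (by rw [← hγ, ← hb']; exact ht) := by
  subst hb hb' hγ; rfl

theorem ofLoc_loc (ε δ : ℝ≥0) (q : FibArr G) :
    ofLoc ε δ (src q) (tgt q) (loc ε δ q) (src_loc ε δ q) (tgt_loc ε δ q) = q := by
  induction q using ind with
  | h e e' w =>
    have hγ : anchor e = G.tgt (G.inv (chart ε e)) := by simp
    have h1 : sec ε (proj e) = act (G.inv (chart ε e)) e := by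
      refine Eq.symm ((congrArg (act _) (act_chart ε e).symm).trans ?_)
      rw [act_act (by simp) (by simp), G.comp_inv, act_one (by simp)]
    have h2 : act (G.comp (chart δ e') (G.inv (chart ε e)) (by simp [w])) (sec δ (proj e')) =
        act (G.inv (chart ε e)) e' := by
      rw [← act_act (by simp) (by simp [w]), act_chart]
    exact (mk_congr h1 h2 _).trans (mk_act w hγ)

theorem loc_ofLoc (ε δ : ℝ≥0) (b b' : UnivBase G) (γ : G.Arr) (hs : G.src γ = baseVert ε b)
    (ht : G.tgt γ = baseVert δ b') : loc ε δ (ofLoc ε δ b b' γ hs ht) = γ := by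
  have h1 : chart δ (act γ (sec δ b')) = γ := by
    rw [chart_act δ (by simp [ht]), G.comp_congr (chart_sec δ b') rfl, G.one_comp']
  have h2 : G.inv (chart ε (sec ε b)) = G.one (baseVert ε b) := by
    rw [chart_sec]
    exact (G.eq_inv (f := G.one _) (by simp) (G.one_comp' (by simp))).symm
  refine (G.comp_congr h1 h2 (by rw [h1, h2, hs, G.tgt_one])).trans (G.comp_one' _)

/-- Composition `[e', e''] ∘ [e, e'] = [e, e'']`, see `comp_mk`. -/
noncomputable def comp (q p : FibArr G) (h : src q = tgt p) : FibArr G :=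
  ofLoc 0 0 (src p) (tgt q) (G.comp (loc 0 0 q) (loc 0 0 p) (by simp [h])) (by simp) (by simp)

theorem loc_comp_mk (ε δ η : ℝ≥0) {e e' e'' : UnivTotal G} (w : anchor e = anchor e')
    (w' : anchor e' = anchor e'') :
    G.comp (loc δ η (mk e' e'' w')) (loc ε δ (mk e e' w)) (by rw [src_loc, tgt_loc]; rfl) =
      loc ε η (mk e e'' (w.trans w')) := by
  have h1 : G.src (chart η e'') = G.tgt (G.inv (chart δ e')) := by simp [w']
  have h2 : G.src (chart δ e') = G.tgt (G.inv (chart ε e)) := by simp [w]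
  have h3 : G.src (G.comp (chart η e'') (G.inv (chart δ e')) h1) =
      G.tgt (G.comp (chart δ e') (G.inv (chart ε e)) h2) := by simp
  refine (G.assoc' h1 h3).trans (G.comp_congr rfl (G.inv_comp_cancel _ _) _)

theorem comp_mk {e e' e'' : UnivTotal G} (w : anchor e = anchor e') (w' : anchor e' = anchor e'')
    (h : src (mk e' e'' w') = tgt (mk e e' w)) :
    comp (mk e' e'' w') (mk e e' w) h = mk e e'' (w.trans w') :=
  (ofLoc_congr rfl rfl (loc_comp_mk 0 0 0 w w') _ _).trans (ofLoc_loc 0 0 (mk e e'' (w.trans w')))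

/-- An arrow can be represented by a pair with prescribed first component. -/
theorem exists_mk (q : FibArr G) (e : UnivTotal G) (h : src q = proj e) :
    ∃ (e' : UnivTotal G) (w : anchor e = anchor e'), q = mk e e' w := by
  induction q using ind with
  | h f f' w =>
    have h : proj f = proj e := h
    have h1 : G.src (G.inv (chart 0 f)) = G.tgt (chart 0 e) := by simp [h]
    have h2 : anchor f = G.tgt (G.comp (G.inv (chart 0 f)) (chart 0 e) h1) := by simp
    have h3 : act (G.comp (G.inv (chart 0 f)) (chart 0 e) h1) f = e := by
      have : f = act (chart 0 f) (sec 0 (proj e)) := by rw [← h, act_chart]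
      refine (congrArg (act _) this).trans ?_
      rw [act_act (by simp [h]) (by simp), G.comp_inv_cancel, act_chart]
    refine ⟨act (G.comp (G.inv (chart 0 f)) (chart 0 e) h1) f', ?_, ?_⟩
    · rw [anchor_act (w.symm.trans h2)]
      simp
    · rw [← mk_act w h2]
      exact mk_congr h3 rfl _

theorem loc_comp (ε δ η : ℝ≥0) (q p : FibArr G) (h : src q = tgt p) :
    loc ε η (comp q p h) = G.comp (loc δ η q) (loc ε δ p) (by simp [h]) := by
  induction p using ind with
  | h e e' w =>
    obtain ⟨e'', w', rfl⟩ := exists_mk q e' h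
    rw [comp_mk, loc_comp_mk]

@[simp] theorem src_comp (q p : FibArr G) (h : src q = tgt p) : src (comp q p h) = src p :=
  proj_sec _ _

@[simp] theorem tgt_comp (q p : FibArr G) (h : src q = tgt p) : tgt (comp q p h) = tgt q :=
  (proj_act (by simp)).trans (proj_sec _ _)

/-- Inversion `[e, e']⁻¹ = [e', e]`. -/
def inv : FibArr G → FibArr G :=
  lift (fun e e' w => mk e' e w.symm) (fun _ _ w _ h => (mk_act w.symm (w.symm.trans h)).symm)

/-- The identity `[e, e]` of `b`, where `e` is any point over `b`. -/
noncomputable def one (b : UnivBase G) : FibArr G := mk (sec 0 b) (sec 0 b) rfl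

theorem one_proj (e : UnivTotal G) : one (proj e) = mk e e rfl := by
  have h : anchor (sec 0 (proj e)) = G.tgt (chart 0 e) := by simp
  refine (mk_act rfl h).symm.trans (mk_congr ?_ ?_ _) <;> exact act_chart 0 e

theorem continuous_inv : Continuous (inv (G := G)) :=
  continuous_lift _ _ fun _ _ _ _ _ _ w he he' => continuous_mk_comp (fun k => (w k).symm) he' he

theorem continuous_one : Continuous (one (G := G)) := by
  refine continuous_from_compactlyGeneratedSpace _ fun K _ _ _ a ha => ?_
  refine continuous_iff_continuousAt.mpr fun k => ?_
  obtain ⟨ε, hε⟩ := FatRealization.exists_mem_chartSet (a k)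
  refine continuousAt_of_test
    (((FatRealization.isOpen_chartSet ε).preimage ha).mem_nhds hε) fun N _ hN => ?_
  have hs : Continuous fun n : N => sec ε (a n) :=
    (continuousOn_sec ε).comp_continuous (ha.comp continuous_subtype_val) fun n => hN n.2
  refine (continuous_mk_comp (fun _ => rfl) hs hs).congr fun n => ?_
  rw [← one_proj, proj_sec]
  rfl

theorem continuous_comp [WeaklyHausdorff G.Obj] (K : Type u) [TopologicalSpace K] [CompactSpace K]
    [T2Space K] (q p : K → FibArr G) (h : ∀ k, src (q k) = tgt (p k)) (hq : Continuous q)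
    (hp : Continuous p) : Continuous fun k => comp (q k) (p k) (h k) := by
  refine continuous_iff_continuousAt.mpr fun k => ?_
  obtain ⟨ε, hε⟩ := FatRealization.exists_mem_chartSet (src (p k))
  obtain ⟨δ, hδ⟩ := FatRealization.exists_mem_chartSet (tgt (p k))
  obtain ⟨η, hη⟩ := FatRealization.exists_mem_chartSet (tgt (q k))
  have hV := ((((FatRealization.isOpen_chartSet ε).preimage (continuous_src.comp hp)).inter
    ((FatRealization.isOpen_chartSet δ).preimage (continuous_tgt.comp hp))).inter
    ((FatRealization.isOpen_chartSet η).preimage (continuous_tgt.comp hq))).mem_nhds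
    ⟨⟨hε, hδ⟩, hη⟩
  refine continuousAt_of_test hV fun N _ hN => ?_
  have hp' : Continuous fun n : N => p n := hp.comp continuous_subtype_val
  have hq' : Continuous fun n : N => q n := hq.comp continuous_subtype_val
  have h1 : Continuous fun n : N => loc ε δ (p n) :=
    (continuousOn_loc ε δ).comp_continuous hp' fun n => (hN n.2).1
  have h2 : Continuous fun n : N => loc δ η (q n) :=
    (continuousOn_loc δ η).comp_continuous hq' fun n => by
      refine ⟨?_, (hN n.2).2⟩
      have := (hN n.2).1.2
      simp only [mem_preimage, Function.comp_apply] at this ⊢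
      rwa [h n]
  have h3 := G.continuous_comp N (fun n => loc δ η (q n)) (fun n => loc ε δ (p n))
    (fun n => by simp [h]) h2 h1
  have h4 : Continuous fun n : N => sec ε (src (p n)) :=
    (continuousOn_sec ε).comp_continuous (continuous_src.comp hp') fun n => (hN n.2).1.1
  have h5 : Continuous fun n : N => sec η (tgt (q n)) :=
    (continuousOn_sec η).comp_continuous (continuous_tgt.comp hq') fun n => (hN n.2).2
  have h6 := continuous_act N _ _ h3 h5 (fun n => by simp)
  refine (continuous_mk_comp (fun n => ?_) h4 h6).congr fun n => ?_
  · rw [anchor_sec, anchor_act_sec (by simp), G.src_comp, src_loc]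
  · refine Eq.trans ?_ (ofLoc_loc ε η (comp (q n) (p n) (h n)))
    exact ofLoc_congr (src_comp _ _ _).symm (tgt_comp _ _ _).symm (loc_comp ε δ η _ _ (h n)).symm
      (by simp) (by simp)

end FibArr

/-- The fibrant replacement `fib G = ((‖𝔼G‖ ×_{G₀} ‖𝔼G‖) / G ⇉ ‖G‖)`: the gauge groupoid of the
universal principal `G`-bundle `‖𝔼G‖ → ‖G‖`. (If `G₀` is weakly Hausdorff, then `‖𝔼G‖` is a
`G`-space in the category of compactly generated spaces, and this is a topological groupoid.) -/
noncomputable def fib (G : TopGroupoid.{u}) [WeaklyHausdorff G.Obj] : TopGroupoid.{u} where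
  Obj := UnivBase G
  Arr := FibArr G
  src := FibArr.src
  tgt := FibArr.tgt
  one := FibArr.one
  inv := FibArr.inv
  comp := FibArr.comp
  continuous_src := FibArr.continuous_src
  continuous_tgt := FibArr.continuous_tgt
  continuous_one := FibArr.continuous_one
  continuous_inv := FibArr.continuous_inv
  continuous_comp := FibArr.continuous_comp
  src_one _ := UnivTotal.proj_sec _ _
  tgt_one _ := UnivTotal.proj_sec _ _
  src_inv q := by induction q using FibArr.ind; rfl
  tgt_inv q := by induction q using FibArr.ind; rfl
  src_comp := FibArr.src_comp
  tgt_comp := FibArr.tgt_comp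
  comp_one q := by
    induction q using FibArr.ind with
    | h e e' w =>
      have : FibArr.one (FibArr.src (FibArr.mk e e' w)) = FibArr.mk e e rfl := FibArr.one_proj e
      simp only [this, FibArr.comp_mk]
  one_comp q := by
    induction q using FibArr.ind with
    | h e e' w =>
      have : FibArr.one (FibArr.tgt (FibArr.mk e e' w)) = FibArr.mk e' e' rfl := FibArr.one_proj e'
      simp only [this, FibArr.comp_mk]
  comp_inv q := by
    induction q using FibArr.ind with
    | h e e' w => exact (FibArr.comp_mk w.symm w _).trans (FibArr.one_proj e').symm
  inv_comp q := by
    induction q using FibArr.ind with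
    | h e e' w => exact (FibArr.comp_mk w w.symm _).trans (FibArr.one_proj e).symm
  assoc k g f h h' := by
    induction f using FibArr.ind with
    | h e e' w =>
      obtain ⟨e2, w', rfl⟩ := FibArr.exists_mk g e' h'
      obtain ⟨e3, w2, rfl⟩ := FibArr.exists_mk k e2 h
      simp only [FibArr.comp_mk]

end TopGroupoid

namespace TopGroupoid

section FibMap

variable {G G' : TopGroupoid.{u}} (ψ : Hom G G')

/-- The map `‖𝔼G‖ → ‖𝔼G'‖` induced by a functor. -/
def UnivTotal.map : UnivTotal G → UnivTotal G' := Realization.map (translationMap ψ)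

theorem UnivTotal.anchor_map (e : UnivTotal G) :
    UnivTotal.anchor (UnivTotal.map ψ e) = ψ.obj (UnivTotal.anchor e) := by
  induction e using Realization.ind with
  | h t a => exact ψ.src_arr _

theorem UnivTotal.proj_map (e : UnivTotal G) :
    UnivTotal.proj (UnivTotal.map ψ e) = Realization.map ψ (UnivTotal.proj e) := by
  induction e using Realization.ind with
  | h t a => exact Realization.mk_congr (fun _ => ψ.tgt_arr _) fun _ _ => rfl

theorem UnivTotal.map_act {γ : G.Arr} {e : UnivTotal G} (h : UnivTotal.anchor e = G.tgt γ) :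
    UnivTotal.map ψ (UnivTotal.act γ e) = UnivTotal.act (ψ.arr γ) (UnivTotal.map ψ e) := by
  induction e using Realization.ind with
  | h t a =>
    have h' : ∀ i, G'.src ((a.map (translationMap ψ)).vert i) = G'.tgt (ψ.arr γ) := fun i =>
      (ψ.src_arr _).trans ((congrArg ψ.obj (UnivTotal.forall_src_vert h i)).trans (ψ.tgt_arr _).symm)
    rw [UnivTotal.act_mk (UnivTotal.forall_src_vert h)]
    refine Eq.trans ?_ (UnivTotal.act_mk (t := t) h').symm
    exact Realization.mk_congr (fun _ => ψ.arr_comp _ _ _) fun _ _ =>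
      Kify.ext (Subtype.ext (Prod.ext rfl (ψ.arr_comp _ _ _)))

/-- The functor `fib G → fib G'` induced by a functor `ψ : G → G'`, `[e, e'] ↦ [‖𝔼ψ‖ e, ‖𝔼ψ‖ e']`. -/
def fibMap [WeaklyHausdorff G.Obj] [WeaklyHausdorff G'.Obj] : Hom (fib G) (fib G') where
  obj := Realization.map ψ
  arr := FibArr.lift (fun e e' w => FibArr.mk (UnivTotal.map ψ e) (UnivTotal.map ψ e')
      (by rw [UnivTotal.anchor_map, UnivTotal.anchor_map, w])) (by
    intro e e' w γ h
    have h' : UnivTotal.anchor (UnivTotal.map ψ e) = G'.tgt (ψ.arr γ) := by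
      rw [UnivTotal.anchor_map, h, ψ.tgt_arr]
    refine (FibArr.mk_act _ h').symm.trans (FibArr.mk_congr ?_ ?_ _)
    · rw [UnivTotal.map_act ψ h]
    · rw [UnivTotal.map_act ψ (w.symm.trans h)])
  continuous_obj := Realization.continuous_map ψ
  continuous_arr := FibArr.continuous_lift _ _ fun _ _ _ _ _ _ _ he he' =>
    FibArr.continuous_mk_comp _ ((Realization.continuous_map _).comp he)
      ((Realization.continuous_map _).comp he')
  src_arr f := by
    induction f using FibArr.ind with
    | h e e' w => exact UnivTotal.proj_map ψ e
  tgt_arr f := by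
    induction f using FibArr.ind with
    | h e e' w => exact UnivTotal.proj_map ψ e'
  arr_one x := by
    refine (FibArr.one_proj _).symm.trans (congrArg FibArr.one ?_)
    exact (UnivTotal.proj_map ψ _).trans (congrArg (Realization.map ψ) (UnivTotal.proj_sec 0 x))
  arr_comp g f h := by
    induction f using FibArr.ind with
    | h e e' w =>
      obtain ⟨e2, w', rfl⟩ := FibArr.exists_mk g e' h
      exact (congrArg (FibArr.lift _ _) (FibArr.comp_mk w w' h)).trans
        (FibArr.comp_mk _ _ rfl).symm

end FibMap

/-! ### The groupoid of functors -/

namespace Hom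

variable {H G : TopGroupoid.{u}}

/-- A continuous natural transformation between functors of topological groupoids. -/
@[ext]
structure Trans (F F' : Hom H G) : Type u where
  /-- The components. -/
  app : H.Obj → G.Arr
  continuous_app : Continuous app
  src_app : ∀ x, G.src (app x) = F.obj x
  tgt_app : ∀ x, G.tgt (app x) = F'.obj x
  naturality : ∀ h : H.Arr,
    G.comp (app (H.tgt h)) (F.arr h) ((src_app _).trans (F.tgt_arr h).symm) =
      G.comp (F'.arr h) (app (H.src h)) ((F'.src_arr h).trans (tgt_app _).symm)

attribute [simp] Trans.src_app Trans.tgt_app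

/-- The groupoid `Hom(H, G)` of continuous functors and continuous natural transformations. -/
instance : CategoryTheory.Groupoid (Hom H G) where
  Hom F F' := Trans F F'
  id F :=
    { app := fun x => G.one (F.obj x)
      continuous_app := G.continuous_one.comp F.continuous_obj
      src_app := by simp
      tgt_app := by simp
      naturality := fun h => by rw [G.one_comp', G.comp_one'] }
  comp {F F' F''} α β :=
    { app := fun x => G.comp (β.app x) (α.app x) (by simp)
      continuous_app := continuous_from_compactlyGeneratedSpace _ fun K _ _ _ a ha =>
        G.continuous_comp K _ _ _ (β.continuous_app.comp ha) (α.continuous_app.comp ha)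
      src_app := by simp
      tgt_app := by simp
      naturality := fun h => by
        rw [G.assoc', G.comp_congr rfl (α.naturality h), ← G.assoc _ _ _ (by simp) (by simp),
          G.comp_congr (β.naturality h) rfl, G.assoc'] }
  inv {F F'} α :=
    { app := fun x => G.inv (α.app x)
      continuous_app := G.continuous_inv.comp α.continuous_app
      src_app := by simp
      tgt_app := by simp
      naturality := fun h => by
        refine G.comp_left_cancel (g := α.app (H.tgt h)) (by simp) (by simp) ?_
        rw [G.comp_inv_cancel, ← G.assoc _ _ _ (by simp) (by simp),
          G.comp_congr (α.naturality h) rfl, G.assoc', G.comp_congr rfl (G.comp_inv _),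
          G.comp_one'] }
  id_comp α := Trans.ext (funext fun x => G.comp_one' _)
  comp_id α := Trans.ext (funext fun x => G.one_comp' _)
  assoc α β γ := Trans.ext (funext fun x => (G.assoc' _ _).symm)
  inv_comp α := Trans.ext (funext fun x => (G.comp_inv _).trans (congrArg G.one (α.tgt_app x)))
  comp_inv α := Trans.ext (funext fun x => (G.inv_comp _).trans (congrArg G.one (α.src_app x)))

end Hom

end TopGroupoid

/-! ### Principal bundles -/

open TopGroupoid

/-- A principal `G`-bundle on a topological groupoid `H`: a principal `G`-bundle `Tot → H₀`
together with an action of `H` on it which covers the action of `H` on `H₀` and commutes with the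
action of `G`. -/
structure PrincipalBundle (G H : TopGroupoid.{u}) : Type (u + 1) where
  /-- The total space. -/
  Tot : Type u
  [top : TopologicalSpace Tot]
  [cg : CompactlyGeneratedSpace Tot]
  /-- The bundle projection. -/
  proj : Tot → H.Obj
  /-- The anchor map of the `G`-space `Tot`. -/
  anchor : Tot → G.Obj
  /-- The left action of `G`. -/
  act : ∀ (g : G.Arr) (p : Tot), G.src g = anchor p → Tot
  /-- The left action of `H`. -/
  hact : ∀ (h : H.Arr) (p : Tot), H.src h = proj p → Tot
  continuous_proj : Continuous proj
  continuous_anchor : Continuous anchor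
  continuous_act : ∀ (K : Type u) [TopologicalSpace K] [CompactSpace K] [T2Space K] (g : K → G.Arr)
    (p : K → Tot) (w : ∀ k, G.src (g k) = anchor (p k)), Continuous g → Continuous p →
    Continuous fun k => act (g k) (p k) (w k)
  continuous_hact : ∀ (K : Type u) [TopologicalSpace K] [CompactSpace K] [T2Space K] (h : K → H.Arr)
    (p : K → Tot) (w : ∀ k, H.src (h k) = proj (p k)), Continuous h → Continuous p →
    Continuous fun k => hact (h k) (p k) (w k)
  anchor_act : ∀ g p w, anchor (act g p w) = G.tgt g
  act_one : ∀ p, act (G.one (anchor p)) p (G.src_one _) = p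
  act_comp : ∀ (g' g : G.Arr) (p : Tot) (w' : G.src g' = G.tgt g) (w : G.src g = anchor p),
    act (G.comp g' g w') p ((G.src_comp _ _ _).trans w) =
      act g' (act g p w) (w'.trans (anchor_act g p w).symm)
  /-- `G` acts along the fibres of `proj`. -/
  proj_act : ∀ g p w, proj (act g p w) = proj p
  /-- `G` acts simply transitively on the fibres of `proj`. -/
  existsUnique_act : ∀ p q : Tot, proj p = proj q →
    ∃! g : G.Arr, ∃ w : G.src g = anchor p, act g p w = q
  /-- The element of `G` which translates `p` to `q` depends continuously on the pair
  `(p, q) ∈ Tot ×_{H₀} Tot`. -/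
  continuous_div : ∀ (K : Type u) [TopologicalSpace K] [CompactSpace K] [T2Space K] (p q : K → Tot)
    (g : K → G.Arr) (w : ∀ k, G.src (g k) = anchor (p k)), Continuous p → Continuous q →
    (∀ k, act (g k) (p k) (w k) = q k) → Continuous g
  /-- The projection has local sections. -/
  exists_section : ∀ x : H.Obj, ∃ (U : Set H.Obj) (σ : H.Obj → Tot), IsOpen U ∧ x ∈ U ∧
    ContinuousOn σ U ∧ ∀ y ∈ U, proj (σ y) = y
  proj_hact : ∀ h p w, proj (hact h p w) = H.tgt h
  hact_one : ∀ p, hact (H.one (proj p)) p (H.src_one _) = p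
  hact_comp : ∀ (h' h : H.Arr) (p : Tot) (w' : H.src h' = H.tgt h) (w : H.src h = proj p),
    hact (H.comp h' h w') p ((H.src_comp _ _ _).trans w) =
      hact h' (hact h p w) (w'.trans (proj_hact h p w).symm)
  anchor_hact : ∀ h p w, anchor (hact h p w) = anchor p
  /-- The actions of `G` and `H` commute. -/
  hact_act : ∀ (h : H.Arr) (g : G.Arr) (p : Tot) (w : H.src h = proj p) (w' : G.src g = anchor p),
    hact h (act g p w') (w.trans (proj_act g p w').symm) =
      act g (hact h p w) (w'.trans (anchor_hact h p w).symm)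

attribute [instance] PrincipalBundle.top PrincipalBundle.cg

namespace PrincipalBundle

/-- A bundle map covering functors `φ : H → H'` and `ψ : G → G'`, from a principal `G`-bundle on `H`
to a principal `G'`-bundle on `H'`: a continuous map of total spaces which is compatible with all
structure maps. If `ψ` is the identity, such a map exhibits `P` as the pullback of `P'` along `φ`,
and if `φ` is the identity, it exhibits `P'` as the bundle associated to `P` along `ψ`. -/
structure BundleMap {G G' H H' : TopGroupoid.{u}} (φ : TopGroupoid.Hom H H')
    (ψ : TopGroupoid.Hom G G') (P : PrincipalBundle G H) (P' : PrincipalBundle G' H') :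
    Type u where
  /-- The map of total spaces. -/
  map : P.Tot → P'.Tot
  continuous_map : Continuous map
  proj_map : ∀ p, P'.proj (map p) = φ.obj (P.proj p)
  anchor_map : ∀ p, P'.anchor (map p) = ψ.obj (P.anchor p)
  map_act : ∀ g p w, map (P.act g p w) = P'.act (ψ.arr g) (map p)
    ((ψ.src_arr g).trans ((congrArg ψ.obj w).trans (anchor_map p).symm))
  map_hact : ∀ h p w, map (P.hact h p w) = P'.hact (φ.arr h) (map p)
    ((φ.src_arr h).trans ((congrArg φ.obj w).trans (proj_map p).symm))

variable {G H : TopGroupoid.{u}}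

/-- An isomorphism of principal `G`-bundles on `H`: a homeomorphism over `H₀` which commutes with
the actions of `G` and `H`. -/
@[ext]
structure Iso (P Q : PrincipalBundle G H) : Type u where
  /-- The homeomorphism of total spaces. -/
  homeo : P.Tot ≃ₜ Q.Tot
  proj_homeo : ∀ p, Q.proj (homeo p) = P.proj p
  anchor_homeo : ∀ p, Q.anchor (homeo p) = P.anchor p
  homeo_act : ∀ g p w, homeo (P.act g p w) = Q.act g (homeo p) (w.trans (anchor_homeo p).symm)
  homeo_hact : ∀ h p w, homeo (P.hact h p w) = Q.hact h (homeo p) (w.trans (proj_homeo p).symm)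

theorem act_congr (P : PrincipalBundle G H) {g g' : G.Arr} {p p' : P.Tot} (hg : g = g') (hp : p = p')
    (w : G.src g = P.anchor p) : P.act g p w = P.act g' p' (by rw [← hg, ← hp]; exact w) := by
  subst hg hp; rfl

theorem hact_congr (P : PrincipalBundle G H) {h h' : H.Arr} {p p' : P.Tot} (hh : h = h')
    (hp : p = p') (w : H.src h = P.proj p) :
    P.hact h p w = P.hact h' p' (by rw [← hh, ← hp]; exact w) := by
  subst hh hp; rfl

/-- The groupoid `M_G(H)` of principal `G`-bundles on `H` and their isomorphisms. -/
instance : CategoryTheory.Groupoid (PrincipalBundle G H) where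
  Hom P Q := Iso P Q
  id P := ⟨Homeomorph.refl _, fun _ => rfl, fun _ => rfl, fun _ _ _ => rfl, fun _ _ _ => rfl⟩
  comp {P Q R} α β :=
    { homeo := α.homeo.trans β.homeo
      proj_homeo := fun p => (β.proj_homeo _).trans (α.proj_homeo p)
      anchor_homeo := fun p => (β.anchor_homeo _).trans (α.anchor_homeo p)
      homeo_act := fun g p w => (congrArg β.homeo (α.homeo_act g p w)).trans (β.homeo_act _ _ _)
      homeo_hact := fun h p w =>
        (congrArg β.homeo (α.homeo_hact h p w)).trans (β.homeo_hact _ _ _) }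
  inv {P Q} α :=
    { homeo := α.homeo.symm
      proj_homeo := fun p => by rw [← α.proj_homeo, α.homeo.apply_symm_apply]
      anchor_homeo := fun p => by rw [← α.anchor_homeo, α.homeo.apply_symm_apply]
      homeo_act := fun g p w => by
        rw [α.homeo.symm_apply_eq, α.homeo_act]
        exact Q.act_congr rfl (α.homeo.apply_symm_apply p).symm _
      homeo_hact := fun h p w => by
        rw [α.homeo.symm_apply_eq, α.homeo_hact]
        exact Q.hact_congr rfl (α.homeo.apply_symm_apply p).symm _ }
  id_comp _ := rfl
  comp_id _ := rfl
  assoc _ _ _ := rfl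
  inv_comp α := Iso.ext (Homeomorph.ext fun p => α.homeo.apply_symm_apply p)
  comp_inv α := Iso.ext (Homeomorph.ext fun p => α.homeo.symm_apply_apply p)

end PrincipalBundle

open CategoryTheory

/-- A family of equivalences of groupoids `Hom(H, fib G) ≌ M_G(H)`, where `H` runs through all
topological groupoids with paracompact Hausdorff object space and `G` through all topological
groupoids with weakly Hausdorff object space. -/
abbrev EquivFamily : Type (u + 1) :=
  ∀ (H G : TopGroupoid.{u}) [ParacompactSpace H.Obj] [T2Space H.Obj] [WeaklyHausdorff G.Obj],
    TopGroupoid.Hom H (fib G) ≌ PrincipalBundle G H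

/-- The data which make a family `e` of equivalences natural in both `H` and `G`.

Given functors `φ : H → H'`, `ψ : G → G'` and objects `F` of `Hom(H, fib G)`, `F'` of
`Hom(H', fib G')`, a morphism from `F` to `F'` over `(φ, ψ)` is a natural transformation
`fib ψ ∘ F ⟶ F' ∘ φ`, and a morphism from a principal `G`-bundle on `H` to a principal `G'`-bundle
on `H'` over `(φ, ψ)` is a bundle map covering `φ` and `ψ`. Naturality says that the functors `e H G`
extend functorially to these morphisms. For `ψ = id` and `F = F' ∘ φ` this compares
`e (F' ∘ φ)` with the pullback of `e F'` along `φ`; for `φ = id` and `F' = fib ψ ∘ F` it compares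
`e (fib ψ ∘ F)` with the bundle associated to `e F` along `ψ`. -/
structure Naturality (e : EquivFamily.{u}) : Type (u + 1) where
  /-- The bundle map induced by a morphism over `(φ, ψ)`. -/
  mapOver : ∀ {H H' G G' : TopGroupoid.{u}} [ParacompactSpace H.Obj] [T2Space H.Obj]
    [ParacompactSpace H'.Obj] [T2Space H'.Obj] [WeaklyHausdorff G.Obj] [WeaklyHausdorff G'.Obj]
    (φ : TopGroupoid.Hom H H') (ψ : TopGroupoid.Hom G G')
    {F : TopGroupoid.Hom H (fib G)} {F' : TopGroupoid.Hom H' (fib G')},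
    (F.trans (fibMap ψ) ⟶ φ.trans F') →
      PrincipalBundle.BundleMap φ ψ ((e H G).functor.obj F) ((e H' G').functor.obj F')
  /-- Over the identities of `H` and `G` one gets the functor `e H G`. -/
  mapOver_id : ∀ {H G : TopGroupoid.{u}} [ParacompactSpace H.Obj] [T2Space H.Obj]
    [WeaklyHausdorff G.Obj] {F F' : TopGroupoid.Hom H (fib G)} (α : F ⟶ F')
    (α' : F.trans (fibMap (TopGroupoid.Hom.id G)) ⟶ (TopGroupoid.Hom.id H).trans F'),
    (∀ x, Hom.Trans.app α' x = Hom.Trans.app α x) →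
    ∀ p, (mapOver (TopGroupoid.Hom.id H) (TopGroupoid.Hom.id G) α').map p =
      PrincipalBundle.Iso.homeo ((e H G).functor.map α) p
  /-- Compatibility with composition. -/
  mapOver_comp : ∀ {H H' H'' G G' G'' : TopGroupoid.{u}} [ParacompactSpace H.Obj] [T2Space H.Obj]
    [ParacompactSpace H'.Obj] [T2Space H'.Obj] [ParacompactSpace H''.Obj] [T2Space H''.Obj]
    [WeaklyHausdorff G.Obj] [WeaklyHausdorff G'.Obj] [WeaklyHausdorff G''.Obj]
    (φ : TopGroupoid.Hom H H') (φ' : TopGroupoid.Hom H' H'') (ψ : TopGroupoid.Hom G G')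
    (ψ' : TopGroupoid.Hom G' G'') {F : TopGroupoid.Hom H (fib G)} {F' : TopGroupoid.Hom H' (fib G')}
    {F'' : TopGroupoid.Hom H'' (fib G'')} (α : F.trans (fibMap ψ) ⟶ φ.trans F')
    (α' : F'.trans (fibMap ψ') ⟶ φ'.trans F'')
    (α'' : F.trans (fibMap (ψ.trans ψ')) ⟶ (φ.trans φ').trans F''),
    (∀ x, ∃ w, Hom.Trans.app α'' x =
      (fib G'').comp (Hom.Trans.app α' (φ.obj x)) ((fibMap ψ').arr (Hom.Trans.app α x)) w) →
    ∀ p, (mapOver (φ.trans φ') (ψ.trans ψ') α'').map p = (mapOver φ' ψ' α').map ((mapOver φ ψ α).map p)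

/-! ### Local continuity -/

/-! The gauge groupoid `fib G` acts on the universal bundle `‖𝔼G‖`: an arrow `[e, e']` carries `e`
to `e'`, and this transport commutes with `G`. A functor `F : H → fib G` therefore gives the
pullback `H₀ ×_{‖G‖} ‖𝔼G‖` of the universal bundle along `F.obj`, on which `h` acts by transport
along `F.arr h`. This is `PrincipalBundle.ofFunctor`. A natural transformation acts by transport
too, since its components are arrows of `fib G`. The same formula, preceded by `‖𝔼ψ‖`, gives the
bundle map over a pair `(φ, ψ)` (`mapOver`), so that naturality in both variables comes from the
functoriality of transport (`transport_comp`, `fibMap_transport`).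

The functor is fully faithful because an arrow of `fib G` amounts to a `G`-equivariant map between
two fibres of the universal bundle. An arrow is recovered from its effect on one point by
`mk_transport`. Conversely an isomorphism `m` of pullback bundles has the components `[e, m e]`,
which are independent of `e` in the fibre by equivariance (`isoArr_eq`), continuous because of local
sections, and natural because `m` commutes with `H`.

Essential surjectivity is where paracompactness enters. A partition of unity on `H₀` subordinate to
local sections `s_i` of `P` sends `p` to the point of `‖𝔼G‖` with barycentric coordinates `ρ_i(x)`,
where `x` is the projection of `p`, and vertices the arrows translating `p` to `s_i(x)`. This
equivariant map `f : P → ‖𝔼G‖` (`exists_classifying_map`) yields the functor `x ↦ proj (f p)`, `h ↦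
[f p, f (h p)]`, for any `p` over the relevant object. The map `p ↦ (proj p, f p)` identifies `P`
with its pullback bundle, since a continuous equivariant map of principal bundles on `H` is an
isomorphism (`Iso.ofMap`).

Algebraic formulas use the charts with threshold `0`, which are defined everywhere but are not
claimed to be continuous, as `chartSet _ 0` is empty. Continuity is proved in the charts with
positive threshold, whose chart sets cover, after checking that the formula does not depend on the
threshold. -/

/-- Compact Hausdorff spaces are locally compact, so a test map may be shrunk to a compact set lying
over a single chart. Such a set is again a legitimate test space for the continuity axioms. -/
theorem TopGpd.continuous_of_local_test {K Z : Type u} [TopologicalSpace K] [CompactSpace K]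
    [T2Space K] [TopologicalSpace Z] {f : K → Z}
    (hf : ∀ k, ∃ V ∈ 𝓝 k, ∀ (N : Set K), CompactSpace N → N ⊆ V → Continuous fun n : N => f n) :
    Continuous f :=
  continuous_iff_continuousAt.mpr fun k => by
    obtain ⟨V, hV, h⟩ := hf k
    exact continuousAt_of_test hV h

/-! ### Transport of points of `‖𝔼G‖` along arrows of `fib G` -/

namespace TopGroupoid

open scoped NNReal

namespace UnivTotal

variable {G G' G'' : TopGroupoid.{u}}

theorem map_id (e : UnivTotal G) : map (Hom.id G) e = e := by
  induction e using Realization.ind with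
  | h t a => rfl

theorem map_trans (ψ : Hom G G') (ψ' : Hom G' G'') (e : UnivTotal G) :
    map (ψ.trans ψ') e = map ψ' (map ψ e) := by
  induction e using Realization.ind with
  | h t a => rfl

theorem continuous_map (ψ : Hom G G') : Continuous (map ψ) := Realization.continuous_map _

/-- By `act_chart`, `e` is the translate of the section over `proj e` by `chart ε e`. -/
theorem ext_chart (ε : ℝ≥0) {e e' : UnivTotal G} (hp : proj e = proj e')
    (hc : chart ε e = chart ε e') : e = e' := by
  rw [← act_chart ε e, ← act_chart ε e', hp, hc]

/-- Division in the universal bundle is continuous. -/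
theorem continuous_of_act_eq {K : Type u} [TopologicalSpace K] [CompactSpace K] [T2Space K]
    {e e' : K → UnivTotal G} {γ : K → G.Arr} (h : ∀ k, anchor (e k) = G.tgt (γ k))
    (he : Continuous e) (he' : Continuous e') (hγ : ∀ k, act (γ k) (e k) = e' k) :
    Continuous γ := by
  refine continuous_of_local_test fun k => ?_
  obtain ⟨ε, hε⟩ := FatRealization.exists_mem_chartSet (proj (e k))
  refine ⟨_, ((FatRealization.isOpen_chartSet ε).preimage (continuous_proj.comp he)).mem_nhds hε,
    fun N _ hN => ?_⟩
  have hp : ∀ k, proj (e' k) = proj (e k) := fun k => by rw [← hγ, proj_act (h k)]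
  have h1 : Continuous fun n : N => chart ε (e n) :=
    (continuousOn_chart ε).comp_continuous (he.comp continuous_subtype_val)
      fun n => proj_mem_chartSet.mp (hN n.2)
  have h2 : Continuous fun n : N => chart ε (e' n) :=
    (continuousOn_chart ε).comp_continuous (he'.comp continuous_subtype_val)
      fun n => proj_mem_chartSet.mp (by rw [hp]; exact hN n.2)
  -- The chart is equivariant, `chart e' = chart e ∘ γ`, so `γ` equals `(chart e)⁻¹ ∘ chart e'` on
  -- this set.
  refine (G.continuous_comp N _ _ (fun n => ?_) (G.continuous_inv.comp h1) h2).congr fun n => ?_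
  · simp [hp]
  · have h3 := chart_act ε (h n)
    rw [hγ] at h3
    exact (G.comp_congr rfl h3 _).trans (G.inv_comp_cancel _ _)

end UnivTotal

namespace FibArr

open UnivTotal

variable {G G' : TopGroupoid.{u}}

/-- The point `e'` such that `q = [e, e']`. -/
noncomputable def transport (q : FibArr G) (e : UnivTotal G) (h : src q = proj e) : UnivTotal G :=
  act (G.comp (loc 0 0 q) (chart 0 e) (by simp [h])) (sec 0 (tgt q))

/-- In charts `[e, e']` is `chart δ e' ∘ (chart ε e)⁻¹`, and composing with `chart ε e` leaves
`chart δ e'`. The thresholds are arbitrary: the value `0` gives the algebra of `transport`, positive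
values its continuity. -/
theorem act_loc_mk (ε δ : ℝ≥0) {e e' : UnivTotal G} (w : anchor e = anchor e') :
    act (G.comp (loc ε δ (mk e e' w)) (chart ε e) (by rw [src_loc, tgt_chart]; rfl))
      (sec δ (tgt (mk e e' w))) = e' := by
  have h1 : G.src (chart δ e') = G.tgt (G.inv (chart ε e)) := by simp [w]
  have h2 : G.comp (loc ε δ (mk e e' w)) (chart ε e) (by rw [src_loc, tgt_chart]; rfl) =
      chart δ e' := by
    refine (G.assoc' h1 (by simp)).trans ?_
    rw [G.comp_congr rfl (G.inv_comp _), G.comp_one']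
  rw [h2]
  exact act_chart δ e'

theorem transport_mk {e e' : UnivTotal G} (w : anchor e = anchor e')
    (h : src (mk e e' w) = proj e) : transport (mk e e' w) e h = e' :=
  act_loc_mk 0 0 w

/-- Together with `exists_mk` this characterises transport without charts: any representative of `q`
that starts at `e` computes it. -/
theorem transport_eq {q : FibArr G} {e e' : UnivTotal G} (h : src q = proj e)
    (w : anchor e = anchor e') (hq : q = mk e e' w) : transport q e h = e' := by
  subst hq
  exact transport_mk w h

theorem transport_congr {q q' : FibArr G} {e e' : UnivTotal G} (hq : q = q') (he : e = e')
    (h : src q = proj e) : transport q e h = transport q' e' (by rw [← hq, ← he]; exact h) := by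
  subst hq he; rfl

theorem anchor_transport (q : FibArr G) (e : UnivTotal G) (h : src q = proj e) :
    anchor (transport q e h) = anchor e := by
  obtain ⟨e', w, rfl⟩ := exists_mk q e h
  rw [transport_mk, w]

theorem mk_transport (q : FibArr G) (e : UnivTotal G) (h : src q = proj e) :
    mk e (transport q e h) (anchor_transport q e h).symm = q := by
  obtain ⟨e', w, rfl⟩ := exists_mk q e h
  exact mk_congr rfl (transport_mk w h) _

theorem proj_transport (q : FibArr G) (e : UnivTotal G) (h : src q = proj e) :
    proj (transport q e h) = tgt q := by
  obtain ⟨e', w, rfl⟩ := exists_mk q e h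
  rw [transport_mk]
  rfl

/-- Arrows are orbits of pairs, so `[e, e']` is also represented by the pair of translates by `γ`.
-/
theorem transport_act (q : FibArr G) (e : UnivTotal G) (h : src q = proj e) {γ : G.Arr}
    (hγ : anchor e = G.tgt γ) :
    transport q (act γ e) (h.trans (proj_act hγ).symm) = act γ (transport q e h) := by
  obtain ⟨e', w, rfl⟩ := exists_mk q e h
  rw [transport_mk]
  exact transport_eq _ _ (mk_act w hγ).symm

theorem transport_one {b : UnivBase G} {e : UnivTotal G} (h : src (one b) = proj e) :
    transport (one b) e h = e := by
  have hb : b = proj e := (proj_sec 0 b).symm.trans h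
  exact transport_eq _ rfl ((congrArg one hb).trans (one_proj e))

theorem transport_comp {q p : FibArr G} (e : UnivTotal G) (h : src q = tgt p)
    (hp : src p = proj e) (h' : src (comp q p h) = proj e) :
    transport (comp q p h) e h' =
      transport q (transport p e hp) (h.trans (proj_transport p e hp).symm) := by
  obtain ⟨e', w, rfl⟩ := exists_mk p e hp
  obtain ⟨e'', w', rfl⟩ := exists_mk q e' h
  rw [transport_eq h' _ (comp_mk w w' h)]
  exact (transport_eq _ ((anchor_transport _ _ _).trans (w.trans w'))
    (mk_congr (transport_mk w hp).symm rfl _)).symm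

theorem continuous_transport [WeaklyHausdorff G.Obj] {K : Type u} [TopologicalSpace K]
    [CompactSpace K] [T2Space K] {q : K → FibArr G} {e : K → UnivTotal G}
    (h : ∀ k, src (q k) = proj (e k)) (hq : Continuous q) (he : Continuous e) :
    Continuous fun k => transport (q k) (e k) (h k) := by
  refine continuous_of_local_test fun k => ?_
  obtain ⟨ε, hε⟩ := FatRealization.exists_mem_chartSet (src (q k))
  obtain ⟨δ, hδ⟩ := FatRealization.exists_mem_chartSet (tgt (q k))
  refine ⟨_, (((FatRealization.isOpen_chartSet ε).preimage (continuous_src.comp hq)).inter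
    ((FatRealization.isOpen_chartSet δ).preimage (continuous_tgt.comp hq))).mem_nhds ⟨hε, hδ⟩,
    fun N _ hN => ?_⟩
  have hq' : Continuous fun n : N => q n := hq.comp continuous_subtype_val
  have h1 : Continuous fun n : N => loc ε δ (q n) :=
    (continuousOn_loc ε δ).comp_continuous hq' fun n => hN n.2
  have h2 : Continuous fun n : N => chart ε (e n) :=
    (continuousOn_chart ε).comp_continuous (he.comp continuous_subtype_val)
      fun n => proj_mem_chartSet.mp (by rw [← h]; exact (hN n.2).1)
  have h3 : Continuous fun n : N => sec δ (tgt (q n)) :=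
    (continuousOn_sec δ).comp_continuous (continuous_tgt.comp hq') fun n => (hN n.2).2
  have h4 := G.continuous_comp N _ _ (fun n => by simp [h]) h1 h2
  -- The expression in the charts `ε`, `δ` is continuous on `N`; by `act_loc_mk` it equals
  -- transport, which was defined with threshold `0`.
  refine (continuous_act N _ _ h4 h3 fun n => by simp).congr fun n => ?_
  obtain ⟨e', w, hw⟩ := exists_mk (q n) (e n) (h n)
  rw [transport_eq (h n) w hw]
  simp only [hw]
  exact act_loc_mk ε δ w

end FibArr

/-! ### Transport and functors between structure groupoids -/

section FibMap

variable {G G' : TopGroupoid.{u}} [WeaklyHausdorff G.Obj] [WeaklyHausdorff G'.Obj]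

theorem fibMap_id_obj (x : UnivBase G) : (fibMap (Hom.id G)).obj x = x := by
  induction x using Realization.ind with
  | h t a => rfl

theorem fibMap_id_arr (q : FibArr G) : (fibMap (Hom.id G)).arr q = q := by
  induction q using FibArr.ind with
  | h e e' w => exact FibArr.mk_congr (UnivTotal.map_id e) (UnivTotal.map_id e') _

/-- `fibMap ψ` applies `‖𝔼ψ‖` to both components of a representing pair. -/
theorem fibMap_transport (ψ : Hom G G') (q : FibArr G) (e : UnivTotal G)
    (h : FibArr.src q = UnivTotal.proj e)
    (h' : FibArr.src ((fibMap ψ).arr q) = UnivTotal.proj (UnivTotal.map ψ e)) :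
    FibArr.transport ((fibMap ψ).arr q) (UnivTotal.map ψ e) h' =
      UnivTotal.map ψ (FibArr.transport q e h) := by
  obtain ⟨e', w, rfl⟩ := FibArr.exists_mk q e h
  rw [FibArr.transport_mk]
  exact FibArr.transport_eq _ (by rw [UnivTotal.anchor_map, UnivTotal.anchor_map, w]) rfl

end FibMap

end TopGroupoid

/-! ### Principal bundles -/

namespace PrincipalBundle

variable {G H : TopGroupoid.{u}} (P : PrincipalBundle G H)

theorem surjective_proj : Function.Surjective P.proj := fun x => by
  obtain ⟨U, σ, -, hx, -, h⟩ := P.exists_section x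
  exact ⟨σ x, h x hx⟩

/-- The arrow which translates `p` to `q`. -/
noncomputable def div (p q : P.Tot) (h : P.proj p = P.proj q) : G.Arr :=
  (P.existsUnique_act p q h).choose

variable {P}

@[simp] theorem src_div {p q : P.Tot} (h : P.proj p = P.proj q) :
    G.src (P.div p q h) = P.anchor p :=
  (P.existsUnique_act p q h).choose_spec.1.choose

theorem act_div {p q : P.Tot} (h : P.proj p = P.proj q) :
    P.act (P.div p q h) p (src_div h) = q :=
  (P.existsUnique_act p q h).choose_spec.1.choose_spec

@[simp] theorem tgt_div {p q : P.Tot} (h : P.proj p = P.proj q) :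
    G.tgt (P.div p q h) = P.anchor q := by
  rw [← P.anchor_act _ p (src_div h), act_div]

/-- The uniqueness half of simple transitivity; it reduces each identity between translation
elements to an identity between points. -/
theorem eq_div {p q : P.Tot} {g : G.Arr} (w : G.src g = P.anchor p) (hg : P.act g p w = q)
    (h : P.proj p = P.proj q) : g = P.div p q h :=
  (P.existsUnique_act p q h).choose_spec.2 g ⟨w, hg⟩

theorem div_comp {p q r : P.Tot} (h : P.proj p = P.proj q) (h' : P.proj q = P.proj r) :
    G.comp (P.div q r h') (P.div p q h) (by simp) = P.div p r (h.trans h') := by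
  refine eq_div (by simp) ?_ _
  rw [P.act_comp _ _ _ _ (by simp)]
  exact (P.act_congr rfl (act_div h) _).trans (act_div h')

theorem div_act {p q : P.Tot} (h : P.proj p = P.proj q) {g : G.Arr} (w : G.src g = P.anchor p)
    (h' : P.proj (P.act g p w) = P.proj q) :
    P.div (P.act g p w) q h' = G.comp (P.div p q h) (G.inv g) (by simp [w]) := by
  refine (eq_div (by simp [P.anchor_act]) ?_ _).symm
  rw [← P.act_comp _ _ _ (by simp) w]
  refine (P.act_congr ?_ rfl _).trans (act_div h)
  rw [G.assoc', G.comp_congr rfl (G.inv_comp g), G.comp_one']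

theorem act_left_injective {p : P.Tot} {g : G.Arr} (w : G.src g = P.anchor p)
    (h : P.act g p w = p) : g = G.one (P.anchor p) :=
  (eq_div w h rfl).trans (eq_div (G.src_one _) (P.act_one p) rfl).symm

theorem continuous_div_comp {K : Type u} [TopologicalSpace K] [CompactSpace K] [T2Space K]
    {p q : K → P.Tot} (h : ∀ k, P.proj (p k) = P.proj (q k)) (hp : Continuous p)
    (hq : Continuous q) : Continuous fun k => P.div (p k) (q k) (h k) :=
  P.continuous_div K p q _ (fun k => src_div (h k)) hp hq fun k => act_div (h k)

/-! ### Equivariant maps of principal bundles -/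

section OfMap

variable {Q : PrincipalBundle G H} {m : P.Tot → Q.Tot}

/-- Each fibre is a torsor on both sides. Freeness of the action on `Q` gives injectivity; for
surjectivity, any point of `P` in the right fibre is corrected by a translation. -/
theorem bijective_of_equivariant (hproj : ∀ p, Q.proj (m p) = P.proj p)
    (hanchor : ∀ p, Q.anchor (m p) = P.anchor p)
    (hact : ∀ g p w, m (P.act g p w) = Q.act g (m p) (w.trans (hanchor p).symm)) :
    Function.Bijective m := by
  constructor
  · intro p q hpq
    have h : P.proj p = P.proj q := by rw [← hproj p, hpq, hproj]
    have h1 : Q.act (P.div p q h) (m p) ((src_div h).trans (hanchor p).symm) = m p := by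
      rw [← hact _ _ (src_div h), act_div, hpq]
    have h2 := act_left_injective _ h1
    rw [← act_div h]
    refine Eq.symm ((P.act_congr (h2.trans (congrArg G.one (hanchor p))) rfl _).trans
      (P.act_one p))
  · intro q
    obtain ⟨p, hp⟩ := P.surjective_proj (Q.proj q)
    have h : Q.proj (m p) = Q.proj q := (hproj p).trans hp
    exact ⟨P.act (Q.div _ _ h) p ((src_div h).trans (hanchor p)), by rw [hact, act_div]⟩

/-- With `σ` a local section of `P`, taken at the projection of `m p`, one has `p = div (m σ) (m p)
· σ`. The right-hand side involves `p` only through `m p`. -/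
theorem continuous_of_comp_equivariant (hm : Continuous m)
    (hproj : ∀ p, Q.proj (m p) = P.proj p) (hanchor : ∀ p, Q.anchor (m p) = P.anchor p)
    (hact : ∀ g p w, m (P.act g p w) = Q.act g (m p) (w.trans (hanchor p).symm))
    {K : Type u} [TopologicalSpace K] [CompactSpace K] [T2Space K] {p : K → P.Tot}
    (hp : Continuous fun k => m (p k)) : Continuous p := by
  refine continuous_of_local_test fun k => ?_
  obtain ⟨U, σ, hU, hk, hσ, hσ'⟩ := P.exists_section (Q.proj (m (p k)))
  refine ⟨_, (hU.preimage (Q.continuous_proj.comp hp)).mem_nhds hk, fun N _ hN => ?_⟩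
  have hp' : Continuous fun n : N => m (p n) := hp.comp continuous_subtype_val
  have h1 : Continuous fun n : N => σ (Q.proj (m (p n))) :=
    hσ.comp_continuous (Q.continuous_proj.comp hp') fun n => hN n.2
  have h2 : ∀ n : N, Q.proj (m (σ (Q.proj (m (p n))))) = Q.proj (m (p n)) := fun n =>
    (hproj _).trans (hσ' _ (hN n.2))
  have h3 := continuous_div_comp h2 (hm.comp h1) hp'
  refine (P.continuous_act N _ _ (fun n => (src_div (h2 n)).trans (hanchor _)) h3 h1).congr
    fun n => ?_
  refine (bijective_of_equivariant hproj hanchor hact).injective ?_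
  rw [hact, act_div]

/-- A continuous equivariant map of principal bundles on `H` is an isomorphism. -/
noncomputable def Iso.ofMap (m : P.Tot → Q.Tot) (hm : Continuous m)
    (hproj : ∀ p, Q.proj (m p) = P.proj p) (hanchor : ∀ p, Q.anchor (m p) = P.anchor p)
    (hact : ∀ g p w, m (P.act g p w) = Q.act g (m p) (w.trans (hanchor p).symm))
    (hhact : ∀ h p w, m (P.hact h p w) = Q.hact h (m p) (w.trans (hproj p).symm)) : Iso P Q where
  homeo :=
    { Equiv.ofBijective m (bijective_of_equivariant hproj hanchor hact) with
      continuous_toFun := hm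
      -- The inverse is tested on `a : K → Q.Tot`: composing `m⁻¹ ∘ a` with `m` gives back the
      -- continuous map `a`.
      continuous_invFun := continuous_from_compactlyGeneratedSpace _ fun K _ _ _ a ha => by
        refine continuous_of_comp_equivariant hm hproj hanchor hact (ha.congr fun k => ?_)
        exact ((Equiv.ofBijective m
          (bijective_of_equivariant hproj hanchor hact)).apply_symm_apply (a k)).symm }
  proj_homeo := hproj
  anchor_homeo := hanchor
  homeo_act := hact
  homeo_hact := hhact

end OfMap

end PrincipalBundle

/-! ### The bundle of a functor `H → fib G` -/

namespace PrincipalBundle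

open UnivTotal

theorem anchor_map_act {G G' : TopGroupoid.{u}} (ψ : TopGroupoid.Hom G G') {g : G.Arr} {e : UnivTotal G}
    (h : UnivTotal.anchor e = G.tgt g) : UnivTotal.anchor (UnivTotal.map ψ e) = G'.tgt (ψ.arr g) := by
  rw [UnivTotal.anchor_map, h, ψ.tgt_arr]

variable {G H : TopGroupoid.{u}} [WeaklyHausdorff G.Obj]

/-- The pullback `H₀ ×_{‖G‖} ‖𝔼G‖` of the universal bundle along the object map of a functor. -/
abbrev PullbackTot (F : TopGroupoid.Hom H (fib G)) : Type u :=
  Kify {z : H.Obj × UnivTotal G // UnivTotal.proj z.2 = F.obj z.1}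

namespace PullbackTot

variable {F : TopGroupoid.Hom H (fib G)}

/-- The point `(x, e)`. -/
def of (x : H.Obj) (e : UnivTotal G) (h : UnivTotal.proj e = F.obj x) : PullbackTot F :=
  ⟨⟨(x, e), h⟩⟩

/-- The component in `H₀`. -/
def base (p : PullbackTot F) : H.Obj := p.out.1.1

/-- The component in `‖𝔼G‖`. -/
def pt (p : PullbackTot F) : UnivTotal G := p.out.1.2

theorem proj_pt (p : PullbackTot F) : UnivTotal.proj p.pt = F.obj p.base := p.out.2

theorem ext' {p q : PullbackTot F} (h : p.base = q.base) (h' : p.pt = q.pt) : p = q :=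
  Kify.ext (Subtype.ext (Prod.ext h h'))

theorem continuous_base : Continuous (base : PullbackTot F → H.Obj) :=
  (continuous_subtype_val.comp Kify.continuous_out).fst

theorem continuous_pt : Continuous (pt : PullbackTot F → UnivTotal G) :=
  (continuous_subtype_val.comp Kify.continuous_out).snd

theorem continuous_of {K : Type u} [TopologicalSpace K] [CompactSpace K] [T2Space K]
    {x : K → H.Obj} {e : K → UnivTotal G} (h : ∀ k, UnivTotal.proj (e k) = F.obj (x k))
    (hx : Continuous x) (he : Continuous e) :
    Continuous fun k => (of (x k) (e k) (h k) : PullbackTot F) :=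
  Kify.continuous_comp_mk ((hx.prodMk he).subtype_mk h)

theorem src_arr {h : H.Arr} {p : PullbackTot F} (w : H.src h = p.base) :
    FibArr.src (F.arr h) = UnivTotal.proj p.pt :=
  (F.src_arr h).trans ((congrArg F.obj w).trans p.proj_pt.symm)

theorem anchor_pt {g : G.Arr} {p : PullbackTot F} (w : G.src g = UnivTotal.anchor p.pt) :
    UnivTotal.anchor p.pt = G.tgt (G.inv g) := by rw [G.tgt_inv, w]

/-- The action of `G`. -/
noncomputable def act (g : G.Arr) (p : PullbackTot F) (w : G.src g = UnivTotal.anchor p.pt) :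
    PullbackTot F :=
  -- `‖𝔼G‖` carries a right action; the inverse turns it into a left action.
  of p.base (UnivTotal.act (G.inv g) p.pt) ((UnivTotal.proj_act (anchor_pt w)).trans p.proj_pt)

/-- The action of `H`. -/
noncomputable def hact (h : H.Arr) (p : PullbackTot F) (w : H.src h = p.base) : PullbackTot F :=
  of (H.tgt h) (FibArr.transport (F.arr h) p.pt (src_arr w))
    ((FibArr.proj_transport _ _ _).trans (F.tgt_arr h))

end PullbackTot

open PullbackTot

/-- The principal `G`-bundle on `H` given by a functor `H → fib G`. -/
noncomputable def ofFunctor (F : TopGroupoid.Hom H (fib G)) : PrincipalBundle G H where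
  Tot := PullbackTot F
  proj := base
  anchor p := UnivTotal.anchor p.pt
  act := PullbackTot.act
  hact := PullbackTot.hact
  continuous_proj := continuous_base
  continuous_anchor := UnivTotal.continuous_anchor.comp continuous_pt
  continuous_act K _ _ _ g p w hg hp := continuous_of _ (continuous_base.comp hp)
    (UnivTotal.continuous_act K _ _ (G.continuous_inv.comp hg) (continuous_pt.comp hp)
      fun k => anchor_pt (w k))
  continuous_hact K _ _ _ h p w hh hp := continuous_of _ (H.continuous_tgt.comp hh)
    (FibArr.continuous_transport (fun k => src_arr (w k)) (F.continuous_arr.comp hh)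
      (continuous_pt.comp hp))
  anchor_act g p w := (UnivTotal.anchor_act (anchor_pt w)).trans (G.src_inv g)
  act_one p := by
    refine PullbackTot.ext' rfl (Eq.trans ?_ (UnivTotal.act_one (e := p.pt) rfl))
    refine congrArg (UnivTotal.act · p.pt) ?_
    exact (G.eq_inv (G.src_one _ |>.trans (G.tgt_one _).symm) (G.one_comp' _)).symm
  act_comp g' g p w' w := PullbackTot.ext' rfl
    ((congrArg (UnivTotal.act · p.pt) (G.inv_comp_rev w')).trans
      (UnivTotal.act_act (anchor_pt w) (by simp [w'])).symm)
  proj_act _ _ _ := rfl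
  existsUnique_act p q h := by
    -- For points `p`, `q` of one fibre the right translation is `(chart p)⁻¹ ∘ chart q`, so the
    -- required element `g` is its inverse.
    have hb : UnivTotal.proj p.pt = UnivTotal.proj q.pt := by
      rw [p.proj_pt, q.proj_pt]; exact congrArg F.obj h
    have hc : G.src (G.inv (UnivTotal.chart 0 p.pt)) = G.tgt (UnivTotal.chart 0 q.pt) := by
      simp [hb]
    have hs : UnivTotal.anchor p.pt =
        G.tgt (G.comp (G.inv (UnivTotal.chart 0 p.pt)) (UnivTotal.chart 0 q.pt) hc) := by simp
    have ha : UnivTotal.act (G.comp (G.inv (UnivTotal.chart 0 p.pt)) (UnivTotal.chart 0 q.pt) hc)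
        p.pt = q.pt := by
      refine UnivTotal.ext_chart 0 ?_ ?_
      · rw [UnivTotal.proj_act hs, hb]
      · rw [UnivTotal.chart_act 0 hs, G.comp_inv_cancel]
    refine ⟨G.inv (G.comp (G.inv (UnivTotal.chart 0 p.pt)) (UnivTotal.chart 0 q.pt) hc),
      ⟨by rw [G.src_inv, hs], PullbackTot.ext' h ?_⟩, ?_⟩
    · refine Eq.trans ?_ ha
      exact congrArg (UnivTotal.act · p.pt) (G.inv_inv _)
    -- Equivariance of the chart determines `g⁻¹` from the charts of `p` and `q`.
    · rintro g ⟨w, hg⟩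
      have h1 : UnivTotal.act (G.inv g) p.pt = q.pt := congrArg PullbackTot.pt hg
      have h2 := UnivTotal.chart_act 0 (anchor_pt w)
      rw [h1] at h2
      rw [G.comp_congr rfl h2, G.inv_comp_cancel, G.inv_inv]
  continuous_div K _ _ _ p q g w hp hq hg := by
    have h1 : Continuous fun k => G.inv (g k) :=
      UnivTotal.continuous_of_act_eq (fun k => anchor_pt (w k)) (continuous_pt.comp hp)
        (continuous_pt.comp hq) fun k => congrArg PullbackTot.pt (hg k)
    exact (G.continuous_inv.comp h1).congr fun k => G.inv_inv _
  exists_section x := by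
    -- Local sections are pulled back from those of the universal bundle.
    obtain ⟨ε, hε⟩ := FatRealization.exists_mem_chartSet (X := nerve G) (F.obj x)
    have hO : IsOpen (F.obj ⁻¹' FatRealization.chartSet (nerve G) ε) :=
      (FatRealization.isOpen_chartSet ε).preimage F.continuous_obj
    refine ⟨_, fun y => of y (UnivTotal.sec ε (F.obj y)) (UnivTotal.proj_sec _ _), hO, hε,
      continuousOn_of_test hO fun K _ _ _ a ha hk => continuous_of _ ha ?_, fun _ _ => rfl⟩
    exact (UnivTotal.continuousOn_sec ε).comp_continuous (F.continuous_obj.comp ha) hk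
  proj_hact _ _ _ := rfl
  hact_one p := PullbackTot.ext' (H.tgt_one _)
    ((FibArr.transport_congr (F.arr_one _) rfl (src_arr (H.src_one p.base))).trans
      (FibArr.transport_one (p.proj_pt.symm ▸ UnivTotal.proj_sec _ _)))
  hact_comp h' h p w' w := PullbackTot.ext' (H.tgt_comp _ _ _)
    ((FibArr.transport_congr (F.arr_comp h' h w') rfl
        (src_arr ((H.src_comp _ _ _).trans w))).trans
      (FibArr.transport_comp (p := F.arr h) p.pt
        ((F.src_arr h').trans ((congrArg F.obj w').trans (F.tgt_arr h).symm)) (src_arr w)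
        ((FibArr.src_comp _ _ _).trans (src_arr w))))
  anchor_hact h p w := FibArr.anchor_transport (F.arr h) p.pt (src_arr w)
  hact_act h g p w w' := PullbackTot.ext' (F := F) rfl
    (FibArr.transport_act _ _ (src_arr w) (anchor_pt w'))

/-! ### Bundle maps induced by natural transformations -/

section MapOver

variable {G' G'' H' H'' : TopGroupoid.{u}} [WeaklyHausdorff G'.Obj] [WeaklyHausdorff G''.Obj]

theorem src_app_over {φ : TopGroupoid.Hom H H'} {ψ : TopGroupoid.Hom G G'}
    {F : TopGroupoid.Hom H (fib G)} {F' : TopGroupoid.Hom H' (fib G')}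
    (α : F.trans (fibMap ψ) ⟶ φ.trans F') (p : PullbackTot F) :
    FibArr.src (Hom.Trans.app α p.base) = UnivTotal.proj (UnivTotal.map ψ p.pt) :=
  (Hom.Trans.src_app α _).trans
    ((congrArg (Realization.map ψ) p.proj_pt.symm).trans (UnivTotal.proj_map ψ p.pt).symm)

/-- The map `(x, e) ↦ (φ x, e')`, where `α x = [‖𝔼ψ‖ e, e']`, of the bundles of two functors
which is induced by a natural transformation `α : fib ψ ∘ F ⟶ F' ∘ φ`. -/
noncomputable def mapOver (φ : TopGroupoid.Hom H H') (ψ : TopGroupoid.Hom G G')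
    {F : TopGroupoid.Hom H (fib G)} {F' : TopGroupoid.Hom H' (fib G')}
    (α : F.trans (fibMap ψ) ⟶ φ.trans F') : BundleMap φ ψ (ofFunctor F) (ofFunctor F') where
  map (p : PullbackTot F) := PullbackTot.of (φ.obj p.base)
    (FibArr.transport (Hom.Trans.app α p.base) (UnivTotal.map ψ p.pt) (src_app_over α p))
    ((FibArr.proj_transport _ _ _).trans (Hom.Trans.tgt_app α _))
  continuous_map := continuous_from_compactlyGeneratedSpace _ fun K _ _ _ a ha =>
    continuous_of _ (φ.continuous_obj.comp (continuous_base.comp ha))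
      (FibArr.continuous_transport (fun k => src_app_over α (a k))
        ((Hom.Trans.continuous_app α).comp (continuous_base.comp ha))
        ((UnivTotal.continuous_map ψ).comp (continuous_pt.comp ha)))
  proj_map _ := rfl
  anchor_map (p : PullbackTot F) := (FibArr.anchor_transport _ _ (src_app_over α p)).trans (UnivTotal.anchor_map ψ p.pt)
  map_act g (p : PullbackTot F) w := by
    refine PullbackTot.ext' rfl ?_
    refine (FibArr.transport_congr rfl ((UnivTotal.map_act ψ (anchor_pt w)).trans
      (congrArg (UnivTotal.act · _) (ψ.arr_inv g)))
      (src_app_over α ((ofFunctor F).act g p w))).trans ?_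
    exact FibArr.transport_act _ _ (src_app_over α p)
      ((anchor_map_act ψ (anchor_pt w)).trans (congrArg G'.tgt (ψ.arr_inv g)))
  map_hact h (p : PullbackTot F) w := by
    refine PullbackTot.ext' (F := F') (φ.tgt_arr h).symm ?_
    -- Both sides are two successive transports of `‖𝔼ψ‖ e`: first along `fib ψ (F h)` and then `α
    -- (tgt h)`, or first along `α (src h)` and then `F' (φ h)`. By `transport_comp` each is one
    -- transport along a composite, and naturality of `α` equates the composites.
    have hα : FibArr.src (Hom.Trans.app α (H.src h)) = UnivTotal.proj (UnivTotal.map ψ p.pt) :=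
      (congrArg (fun x => FibArr.src (Hom.Trans.app α x)) w).trans (src_app_over α p)
    have hF : FibArr.src ((fibMap ψ).arr (F.arr h)) = UnivTotal.proj (UnivTotal.map ψ p.pt) :=
      ((F.trans (fibMap ψ)).src_arr h).trans ((Hom.Trans.src_app α _).symm.trans hα)
    have hG := (Hom.Trans.src_app α (H.tgt h)).trans ((F.trans (fibMap ψ)).tgt_arr h).symm
    have hF' := ((φ.trans F').src_arr h).trans (Hom.Trans.tgt_app α _).symm
    refine (FibArr.transport_congr rfl (fibMap_transport ψ (F.arr h) p.pt (src_arr w) hF).symm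
      (src_app_over α ((ofFunctor F).hact h p w))).trans ?_
    refine (FibArr.transport_comp (UnivTotal.map ψ p.pt) hG hF
      ((FibArr.src_comp _ _ hG).trans hF)).symm.trans ?_
    refine (FibArr.transport_congr (Hom.Trans.naturality α h) rfl
      ((FibArr.src_comp _ _ hG).trans hF)).trans ?_
    refine (FibArr.transport_comp (UnivTotal.map ψ p.pt) hF' hα
      ((FibArr.src_comp _ _ hF').trans hα)).trans ?_
    exact FibArr.transport_congr rfl
      (FibArr.transport_congr (congrArg (Hom.Trans.app α) w) rfl hα)
      (hF'.trans (FibArr.proj_transport _ _ hα).symm)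

/-- Transport along the composite splits into transport along `fib ψ' (α x)` and then along `α'`.
The first of these is the image under `‖𝔼ψ'‖` of transport along `α x`. -/
theorem mapOver_trans {φ : TopGroupoid.Hom H H'} {φ' : TopGroupoid.Hom H' H''}
    {ψ : TopGroupoid.Hom G G'} {ψ' : TopGroupoid.Hom G' G''} {F : TopGroupoid.Hom H (fib G)}
    {F' : TopGroupoid.Hom H' (fib G')} {F'' : TopGroupoid.Hom H'' (fib G'')}
    (α : F.trans (fibMap ψ) ⟶ φ.trans F') (α' : F'.trans (fibMap ψ') ⟶ φ'.trans F'')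
    (α'' : F.trans (fibMap (ψ.trans ψ')) ⟶ (φ.trans φ').trans F'')
    (h : ∀ x, ∃ w, Hom.Trans.app α'' x = (fib G'').comp (Hom.Trans.app α' (φ.obj x))
      ((fibMap ψ').arr (Hom.Trans.app α x)) w) (p : PullbackTot F) :
    (mapOver (φ.trans φ') (ψ.trans ψ') α'').map p =
      (mapOver φ' ψ' α').map ((mapOver φ ψ α).map p) := by
  refine PullbackTot.ext' rfl ?_
  obtain ⟨w, hw⟩ := h p.base
  have h1 : FibArr.src ((fibMap ψ').arr (Hom.Trans.app α p.base)) =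
      UnivTotal.proj (UnivTotal.map ψ' (UnivTotal.map ψ p.pt)) := by
    rw [UnivTotal.proj_map, ← src_app_over α p]
    exact (fibMap ψ').src_arr _
  refine (FibArr.transport_congr hw (UnivTotal.map_trans ψ ψ' p.pt) (src_app_over α'' p)).trans ?_
  refine (FibArr.transport_comp _ w h1 ((FibArr.src_comp _ _ _).trans h1)).trans ?_
  exact FibArr.transport_congr rfl (fibMap_transport ψ' _ _ (src_app_over α p) h1)
    (w.trans (FibArr.proj_transport _ _ h1).symm)

end MapOver

/-! ### The functor to principal bundles and its faithfulness -/

/-- A natural transformation, seen as a morphism over the identities of `H` and `G`. -/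
def overId {F F' : TopGroupoid.Hom H (fib G)} (α : F ⟶ F') :
    F.trans (fibMap (TopGroupoid.Hom.id G)) ⟶ (TopGroupoid.Hom.id H).trans F' :=
  Hom.Trans.mk (Hom.Trans.app α) (Hom.Trans.continuous_app α)
    (fun x => (Hom.Trans.src_app α x).trans (fibMap_id_obj (F.obj x)).symm)
    (Hom.Trans.tgt_app α)
    (fun h => ((fib G).comp_congr rfl (fibMap_id_arr (F.arr h)) _).trans
      (Hom.Trans.naturality α h))

/-- A bundle map over the identities is an isomorphism of principal bundles. -/
noncomputable def BundleMap.toIso {P Q : PrincipalBundle G H}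
    (m : BundleMap (TopGroupoid.Hom.id H) (TopGroupoid.Hom.id G) P Q) : Iso P Q :=
  Iso.ofMap m.map m.continuous_map m.proj_map m.anchor_map m.map_act m.map_hact

/-- The functor `Hom(H, fib G) ⥤ M_G(H)`. -/
noncomputable def functor (H G : TopGroupoid.{u}) [WeaklyHausdorff G.Obj] :
    TopGroupoid.Hom H (fib G) ⥤ PrincipalBundle G H where
  obj := ofFunctor
  map α := (mapOver _ _ (overId α)).toIso
  map_id F := Iso.ext (Homeomorph.ext fun (p : PullbackTot F) => PullbackTot.ext' rfl
    ((FibArr.transport_congr rfl (UnivTotal.map_id p.pt)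
      (src_app_over (overId (𝟙 F)) p)).trans (FibArr.transport_one
      (p.proj_pt.symm ▸ UnivTotal.proj_sec _ _))))
  map_comp {F F' F''} α β := Iso.ext (Homeomorph.ext fun p =>
    mapOver_trans (overId α) (overId β) (overId (α ≫ β))
      (fun x => by
        -- `mapOver_trans` expects the first factor under `fibMap` of the identity, which
        -- `fibMap_id_arr` removes.
        have h := ((Hom.Trans.src_app β x).trans (Hom.Trans.tgt_app α x).symm)
        have h' := fibMap_id_arr (Hom.Trans.app α x)
        exact ⟨h.trans (congrArg FibArr.tgt h').symm, (fib G).comp_congr rfl h'.symm h⟩) p)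

theorem functor_map_pt {F F' : TopGroupoid.Hom H (fib G)} (α : F ⟶ F') (p : PullbackTot F)
    (h : FibArr.src (Hom.Trans.app α p.base) = UnivTotal.proj p.pt) :
    PullbackTot.pt (Iso.homeo ((functor H G).map α) p) =
      FibArr.transport (Hom.Trans.app α p.base) p.pt h :=
  FibArr.transport_congr rfl (UnivTotal.map_id p.pt) (src_app_over (overId α) p)

/-- An arrow `q` is `[e, e']` with `e'` the transport of `e` along `q`, so its effect on a single
point of each fibre determines it. The point used over `x` is the one given by `sec 0`. -/
instance : (functor H G).Faithful where
  map_injective {F F'} α β h := by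
    refine Hom.Trans.ext (funext fun x => ?_)
    let p : PullbackTot F := of x (UnivTotal.sec 0 (F.obj x)) (UnivTotal.proj_sec _ _)
    have hα : FibArr.src (Hom.Trans.app α x) = UnivTotal.proj p.pt :=
      (Hom.Trans.src_app α x).trans p.proj_pt.symm
    have hβ : FibArr.src (Hom.Trans.app β x) = UnivTotal.proj p.pt :=
      (Hom.Trans.src_app β x).trans p.proj_pt.symm
    have h1 : FibArr.transport (Hom.Trans.app α x) p.pt hα =
        FibArr.transport (Hom.Trans.app β x) p.pt hβ := by
      refine (functor_map_pt α p hα).symm.trans (Eq.trans ?_ (functor_map_pt β p hβ))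
      rw [h]
    rw [← FibArr.mk_transport _ _ hα, ← FibArr.mk_transport _ _ hβ]
    exact FibArr.mk_congr rfl h1 _

/-! ### Fullness -/

section Full

variable {F F' : TopGroupoid.Hom H (fib G)} (m : Iso (ofFunctor F) (ofFunctor F'))

theorem anchor_iso_pt (p : PullbackTot F) :
    UnivTotal.anchor p.pt = UnivTotal.anchor (PullbackTot.pt (m.homeo p)) :=
  (m.anchor_homeo p).symm

/-- The arrow `[e, e']`, where `(x, e) ↦ (x, e')` under an isomorphism. -/
noncomputable def isoArr (p : PullbackTot F) : FibArr G :=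
  FibArr.mk p.pt (PullbackTot.pt (m.homeo p)) (anchor_iso_pt m p)

/-- Two points of a fibre differ by some `g`, and `m` is equivariant, so both components of the pair
are translated simultaneously and the orbit is unchanged. -/
theorem isoArr_eq {p q : PullbackTot F} (h : p.base = q.base) : isoArr m p = isoArr m q := by
  obtain ⟨g, ⟨w, hq⟩, -⟩ := (ofFunctor F).existsUnique_act p q h
  refine (FibArr.mk_act (anchor_iso_pt m p) (anchor_pt w)).symm.trans ?_
  refine FibArr.mk_congr (congrArg PullbackTot.pt hq) ?_ _
  refine (congrArg PullbackTot.pt (m.homeo_act g p w)).symm.trans ?_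
  exact congrArg (fun p => PullbackTot.pt (m.homeo p)) hq

theorem continuous_isoArr : Continuous (isoArr m) :=
  continuous_from_compactlyGeneratedSpace _ fun _ _ _ _ _ ha =>
    FibArr.continuous_mk_comp _ (continuous_pt.comp ha)
      (continuous_pt.comp (m.homeo.continuous.comp ha))

theorem tgt_isoArr (p : PullbackTot F) : FibArr.tgt (isoArr m p) = F'.obj p.base :=
  (PullbackTot.proj_pt (m.homeo p)).trans (congrArg F'.obj (m.proj_homeo p))

/-- The action of `h` was defined as transport along `F h`. Writing `F h` as `[e, h e]` makes the
naturality square a composition of pairs. -/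
theorem arr_eq_mk {F : TopGroupoid.Hom H (fib G)} {h : H.Arr} {p : PullbackTot F}
    (w : H.src h = p.base) : F.arr h = FibArr.mk p.pt (PullbackTot.hact h p w).pt
      (FibArr.anchor_transport _ _ (src_arr w)).symm :=
  (FibArr.mk_transport _ _ (src_arr w)).symm

end Full

/-- A function on `H₀` which lifts to a continuous function on a principal bundle is continuous. -/
theorem continuous_of_comp_proj {H G : TopGroupoid.{u}} (P : PrincipalBundle G H) {Z : Type*}
    [TopologicalSpace Z] {f : H.Obj → Z} (h : Continuous fun p => f (P.proj p)) : Continuous f := by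
  refine continuous_iff_continuousAt.mpr fun x => ?_
  obtain ⟨U, σ, hU, hx, hσ, h'⟩ := P.exists_section x
  refine ((h.comp_continuousOn hσ).continuousAt (hU.mem_nhds hx)).congr ?_
  filter_upwards [hU.mem_nhds hx] with y hy
  exact congrArg f (h' y hy)

/-- The transformation with components `[e, m e]` induces `m`, since transport along `[e, m e]`
takes `e` to `m e`. -/
instance : (functor H G).Full where
  map_surjective {F F'} (m : Iso (ofFunctor F) (ofFunctor F')) := by
    let s : ∀ x, PullbackTot F := fun x =>
      of x (UnivTotal.sec 0 (F.obj x)) (UnivTotal.proj_sec _ _)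
    have happ : ∀ p, isoArr m (s p.base) = isoArr m p := fun p => isoArr_eq m rfl
    refine ⟨Hom.Trans.mk (fun x => isoArr m (s x)) ?_ (fun x => (s x).proj_pt)
      (fun x => tgt_isoArr m _) fun h => ?_, ?_⟩
    -- The choice `s` need not be continuous: pulled back to the total space, the components become
    -- `isoArr m`, which is.
    · exact continuous_of_comp_proj (ofFunctor F)
        ((continuous_isoArr m).congr fun p => (happ p).symm)
    · have w : H.src h = (s (H.src h)).base := rfl
      have w' : H.src h = PullbackTot.base (m.homeo (s (H.src h))) :=
        w.trans (m.proj_homeo (s (H.src h))).symm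
      -- With `e` the point chosen over the source of `h`, the component at the target is computed
      -- at `h e`. As `m` commutes with `H`, it is `[h e, h (m e)]`. Both sides of the square then
      -- become `[e, h (m e)]`: one is `[h e, h (m e)] ∘ [e, h e]`, the other `[m e, h (m e)] ∘ [e,
      -- m e]`.
      have e1 : isoArr m (s (H.tgt h)) = isoArr m (PullbackTot.hact h (s (H.src h)) w) :=
        happ (PullbackTot.hact h (s (H.src h)) w)
      have e2 : isoArr m (PullbackTot.hact h (s (H.src h)) w) =
          FibArr.mk (PullbackTot.hact h (s (H.src h)) w).pt
            (PullbackTot.hact h (m.homeo (s (H.src h))) w').pt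
            ((anchor_iso_pt m _).trans (congrArg (fun p => UnivTotal.anchor (PullbackTot.pt p))
              (m.homeo_hact h (s (H.src h)) w))) :=
        FibArr.mk_congr rfl (congrArg PullbackTot.pt (m.homeo_hact h (s (H.src h)) w)) _
      refine ((fib G).comp_congr (e1.trans e2) (arr_eq_mk w) _).trans ?_
      refine (FibArr.comp_mk _ _ rfl).trans ?_
      refine Eq.symm (((fib G).comp_congr (arr_eq_mk w') rfl _).trans ?_)
      exact FibArr.comp_mk _ _ rfl
    · refine Iso.ext (Homeomorph.ext fun p => PullbackTot.ext' (m.proj_homeo p).symm ?_)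
      refine (functor_map_pt _ p ((congrArg FibArr.src (happ p)).trans rfl)).trans ?_
      exact FibArr.transport_eq _ (anchor_iso_pt m p) (happ p)

end PrincipalBundle

/-! ### The classifying map of a principal bundle -/

namespace PrincipalBundle

variable {G H : TopGroupoid.{u}}

/-- Sections of a principal bundle and a partition of unity on `H₀`, indexed by a linearly ordered
set, such that every section is continuous on a neighbourhood of the support of the
corresponding function. -/
structure Numeration (P : PrincipalBundle G H) (I : Type u) [LinearOrder I] : Type u where
  /-- The open sets of the cover. -/
  cover : I → Set H.Obj
  isOpen_cover : ∀ i, IsOpen (cover i)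
  /-- The sections. -/
  sec : I → H.Obj → P.Tot
  proj_sec : ∀ i x, P.proj (sec i x) = x
  continuousOn_sec : ∀ i, ContinuousOn (sec i) (cover i)
  /-- The partition of unity. -/
  unity : PartitionOfUnity I H.Obj
  isSubordinate : unity.IsSubordinate cover

theorem exists_numeration [ParacompactSpace H.Obj] [T2Space H.Obj] (P : PrincipalBundle G H) :
    ∃ (I : Type u) (_ : LinearOrder I), Nonempty (Numeration P I) := by
  classical
  choose U σ hU hx hσ hσ' using P.exists_section
  choose s hs using P.surjective_proj
  obtain ⟨ρ, hρ⟩ := PartitionOfUnity.exists_isSubordinate isClosed_univ U hU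
    (fun x _ => mem_iUnion.mpr ⟨x, hx x⟩)
  -- The points of `H₀` index the cover. Only linearity of this order is used: it orders the
  -- vertices of the simplices below.
  obtain ⟨o, -⟩ := exists_wellFoundedLT H.Obj
  refine ⟨H.Obj, o, ⟨⟨U, hU,
    -- Outside `U i` an arbitrary set-theoretic section `s` is used, so that `proj_sec` holds
    -- everywhere; continuity is needed only on `U i`.
    fun i x => if x ∈ U i then σ i x else s x, fun i x => ?_, fun i => ?_, ρ, hρ⟩⟩⟩
  · split_ifs with h
    · exact hσ' i x h
    · exact hs x
  · exact (hσ i).congr fun x h => if_pos h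

/-! ### Construction of the classifying map from a partition of unity -/

namespace Numeration

variable {P : PrincipalBundle G H} {I : Type u} [LinearOrder I] (S : Numeration P I)

/-- A finite chain of indices which contains all indices of functions not vanishing at `x`. -/
def IsChainAt {n : ℕ} (c : Fin (n + 1) ↪o I) (x : H.Obj) : Prop :=
  ∀ i, i ∉ range c → S.unity i x = 0

variable {S}

theorem IsChainAt.sum_eq_one {n : ℕ} {c : Fin (n + 1) ↪o I} {x : H.Obj} (h : S.IsChainAt c x) :
    ∑ j, S.unity (c j) x = 1 := by
  classical
  rw [← S.unity.sum_eq_one (mem_univ x),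
    finsum_eq_sum_of_support_subset (s := Finset.univ.map c.toEmbedding)]
  · rw [Finset.sum_map]
    rfl
  · intro i hi
    by_contra h'
    refine hi (h i fun ⟨j, hj⟩ => h' ?_)
    simpa using ⟨j, hj⟩

/-- The values at `x` of the functions with index in a chain. -/
def weight {n : ℕ} (c : Fin (n + 1) ↪o I) (x : H.Obj) (h : S.IsChainAt c x) : Simplex n :=
  ⟨fun j => S.unity (c j) x, fun j => S.unity.nonneg (c j) x, h.sum_eq_one⟩

theorem exists_orderEmb {s : Set I} (hs : s.Finite) (hne : s.Nonempty) :
    ∃ (n : ℕ) (c : Fin (n + 1) ↪o I), range c = s := by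
  obtain ⟨n, hn⟩ : ∃ n, hs.toFinset.card = n + 1 :=
    Nat.exists_eq_succ_of_ne_zero (Finset.card_ne_zero.mpr (hs.toFinset_nonempty.mpr hne))
  exact ⟨n, hs.toFinset.orderEmbOfFin hn, by rw [Finset.range_orderEmbOfFin, hs.coe_toFinset]⟩

-- The chain lists exactly the indices with nonzero value at `x`; it is minimal, hence contained in
-- every other chain at `x`.
variable (S) in
theorem exists_isChainAt (x : H.Obj) : ∃ (n : ℕ) (c : Fin (n + 1) ↪o I),
    S.IsChainAt c x ∧ ∀ j, S.unity (c j) x ≠ 0 := by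
  obtain ⟨i, hi⟩ := S.unity.exists_pos (mem_univ x)
  obtain ⟨n, c, hc⟩ := exists_orderEmb (S.unity.locallyFinite.point_finite x) ⟨i, hi.ne'⟩
  refine ⟨n, c, fun i hi => ?_, fun j => ?_⟩
  · by_contra h
    exact hi (hc.symm ▸ h)
  · have : c j ∈ {i | x ∈ Function.support (S.unity i)} := hc ▸ mem_range_self j
    exact this

variable (S) in
/-- A chain which can be used in a neighbourhood of `x`, with continuous sections. -/
theorem exists_nhds_isChainAt (x : H.Obj) : ∃ (n : ℕ) (c : Fin (n + 1) ↪o I) (V : Set H.Obj),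
    V ∈ 𝓝 x ∧ ∀ y ∈ V, S.IsChainAt c y ∧ ∀ j, y ∈ S.cover (c j) := by
  obtain ⟨i, hi⟩ := S.unity.exists_pos (mem_univ x)
  -- Closed supports are taken because, by local finiteness, no new index appears near `x`, and
  -- because subordination then puts `x` in each open set `cover (c j)`.
  have hne : {i | x ∈ tsupport (S.unity i)}.Nonempty := ⟨i, subset_closure hi.ne'⟩
  have hlf : LocallyFinite fun i => tsupport (S.unity i) := S.unity.locallyFinite.closure
  obtain ⟨n, c, hc⟩ := exists_orderEmb (hlf.point_finite x) hne
  have h1 := hlf.eventually_subset (fun i => isClosed_tsupport _) x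
  have h2 : ∀ᶠ y in 𝓝 x, ∀ j, y ∈ S.cover (c j) := Filter.eventually_all.mpr fun j => by
    have : c j ∈ {i | x ∈ tsupport (S.unity i)} := hc ▸ mem_range_self j
    exact (S.isOpen_cover _).mem_nhds (S.isSubordinate _ this)
  refine ⟨n, c, _, h1.and h2, fun y hy => ⟨fun i hi => ?_, hy.2⟩⟩
  by_contra h
  exact hi (hc.symm ▸ hy.1 (subset_closure h))

theorem proj_eq_sec (p : P.Tot) (i : I) : P.proj p = P.proj (S.sec i (P.proj p)) :=
  (S.proj_sec i _).symm

theorem proj_sec_eq_sec (x : H.Obj) (i j : I) : P.proj (S.sec i x) = P.proj (S.sec j x) :=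
  (S.proj_sec i _).trans (S.proj_sec j _).symm

variable (S) in
/-- The simplex of `𝔼G` whose vertices are the arrows which translate `p` to the values of the
sections. -/
noncomputable def simplex {n : ℕ} (c : Fin (n + 1) ↪o I) (p : P.Tot) :
    NerveSimplex (translation G) n :=
  NerveSimplex.of (K := translation G)
    (fun j => P.div p (S.sec (c j) (P.proj p)) (proj_eq_sec p _))
    (fun j k => ⟨⟨(P.div (S.sec (c j) (P.proj p)) (S.sec (c k) (P.proj p))
      (proj_sec_eq_sec _ _ _), P.div p (S.sec (c j) (P.proj p)) (proj_eq_sec p _)), by simp⟩⟩)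
    (fun _ _ => rfl)
    (fun _ _ => div_comp (proj_eq_sec p _) (proj_sec_eq_sec _ _ _))
    (fun _ _ _ => Kify.ext (Subtype.ext (Prod.ext
      (div_comp (proj_sec_eq_sec _ _ _) (proj_sec_eq_sec _ _ _)) rfl)))

variable (S) in
/-- The point of `‖𝔼G‖` given by a chain of indices. -/
noncomputable def point {n : ℕ} (c : Fin (n + 1) ↪o I) (p : P.Tot)
    (h : S.IsChainAt c (P.proj p)) : UnivTotal G :=
  Realization.mk (weight c (P.proj p) h) (S.simplex c p)

/-- The indices of `d` missing from `c` have weight zero, so the simplex of `c` is the face of that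
of `d` on which the point lies, and the gluing relation applies. -/
theorem point_eq_of_range_subset {m n : ℕ} {c : Fin (m + 1) ↪o I} {d : Fin (n + 1) ↪o I}
    (hcd : range c ⊆ range d) {p : P.Tot} (hc : S.IsChainAt c (P.proj p))
    (hd : S.IsChainAt d (P.proj p)) : S.point c p hc = S.point d p hd := by
  choose θ hθ using fun j => hcd (mem_range_self j)
  let Θ : Fin (m + 1) ↪o Fin (n + 1) := OrderEmbedding.ofMapLEIff θ fun j k => by
    rw [← d.le_iff_le, hθ, hθ, c.le_iff_le]
  have hΘ : ∀ j, d (Θ j) = c j := hθ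
  have h1 : S.simplex c p = (S.simplex d p).restrict Θ :=
    congrArg (S.simplex · p) (RelEmbedding.ext hΘ : Θ.trans d = c).symm
  have h2 : stdSimplex.map Θ (weight c (P.proj p) hc) = weight d (P.proj p) hd := by
    refine Subtype.ext (funext fun k => ?_)
    by_cases hk : ∃ j, Θ j = k
    · obtain ⟨j, rfl⟩ := hk
      refine (FatRealization.simplexMap_apply Θ _ j).trans ?_
      exact congrArg (fun i => S.unity i (P.proj p)) (hΘ j).symm
    · push Not at hk
      refine (FatRealization.simplexMap_apply_eq_zero Θ _ k hk).trans (Eq.symm (hc _ ?_))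
      rintro ⟨j, hj⟩
      exact hk j (d.injective ((hΘ j).trans hj))
  unfold point
  rw [h1, Realization.glue, h2]

variable (S) in
/-- The classifying map `P → ‖𝔼G‖`. -/
noncomputable def classify (p : P.Tot) : UnivTotal G :=
  S.point _ p (S.exists_isChainAt (P.proj p)).choose_spec.choose_spec.1

/-- The chosen chain is minimal, so `point_eq_of_range_subset` compares it with any `c`. This lets a
chain be fixed throughout a neighbourhood or an orbit. -/
theorem classify_eq {n : ℕ} {c : Fin (n + 1) ↪o I} {p : P.Tot} (h : S.IsChainAt c (P.proj p)) :
    S.classify p = S.point c p h := by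
  refine point_eq_of_range_subset ?_ _ _
  rintro _ ⟨j, rfl⟩
  by_contra hj
  exact (S.exists_isChainAt (P.proj p)).choose_spec.choose_spec.2 j (h _ hj)

theorem anchor_classify (p : P.Tot) : UnivTotal.anchor (S.classify p) = P.anchor p :=
  src_div (proj_eq_sec p _)

theorem classify_act (g : G.Arr) (p : P.Tot) (w : G.src g = P.anchor p) :
    S.classify (P.act g p w) = UnivTotal.act (G.inv g) (S.classify p) := by
  obtain ⟨n, c, h, -⟩ := S.exists_isChainAt (P.proj p)
  have hp := P.proj_act g p w
  have h' : S.IsChainAt c (P.proj (P.act g p w)) := hp.symm ▸ h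
  -- Sections and weights depend only on the base point. Replacing `p` by `g p` thus multiplies
  -- every vertex on the right by `g⁻¹` and leaves the arrows between the sections alone.
  have hv : ∀ i, P.div (P.act g p w) (S.sec (c i) (P.proj (P.act g p w))) (proj_eq_sec _ _) =
      G.comp (P.div p (S.sec (c i) (P.proj p)) (proj_eq_sec _ _)) (G.inv g) (by simp [w]) := by
    intro i
    rw [← div_act _ w (hp.trans (proj_eq_sec _ _))]
    simp only [hp]
  have hs : ∀ i, G.src ((S.simplex c p).vert i) = G.tgt (G.inv g) := fun i =>
    (src_div (proj_eq_sec p _)).trans (w.symm.trans (G.tgt_inv g).symm)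
  rw [classify_eq h', classify_eq h]
  refine Eq.trans ?_ (UnivTotal.act_mk (t := weight c (P.proj p) h) hs).symm
  have hw : weight c (P.proj (P.act g p w)) h' = weight c (P.proj p) h :=
    Subtype.ext (funext fun j => congrArg (S.unity (c j)) hp)
  unfold point
  rw [hw]
  refine Realization.mk_congr hv fun i j => Kify.ext (Subtype.ext (Prod.ext ?_ (hv i)))
  change P.div _ _ (proj_sec_eq_sec _ _ _) = P.div _ _ (proj_sec_eq_sec _ _ _)
  simp only [hp]

/-- Near each point one fixed chain serves, with sections continuous there; weights and translation
elements are then continuous, and so is the point of `‖𝔼G‖` that they define. -/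
theorem continuous_classify : Continuous S.classify := by
  refine continuous_from_compactlyGeneratedSpace _ fun K _ _ _ p hp => ?_
  refine continuous_of_local_test fun k => ?_
  obtain ⟨n, c, V, hV, h⟩ := S.exists_nhds_isChainAt (P.proj (p k))
  have hx : Continuous fun k => P.proj (p k) := P.continuous_proj.comp hp
  refine ⟨_, hx.continuousAt.preimage_mem_nhds hV, fun N _ hN => ?_⟩
  have hp' : Continuous fun n : N => p n := hp.comp continuous_subtype_val
  have hx' : Continuous fun n : N => P.proj (p n) := hx.comp continuous_subtype_val
  have hs : ∀ j, Continuous fun n : N => S.sec (c j) (P.proj (p n)) := fun j =>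
    (S.continuousOn_sec (c j)).comp_continuous hx' fun n => (h _ (hN n.2)).2 j
  have hw : Continuous fun n : N => weight c (P.proj (p n)) (h _ (hN n.2)).1 :=
    (continuous_pi fun j => (S.unity (c j)).continuous.comp hx').subtype_mk _
  have hd : ∀ j, Continuous fun n : N =>
      P.div (p n) (S.sec (c j) (P.proj (p n))) (proj_eq_sec (p n) _) := fun j =>
    continuous_div_comp _ hp' (hs j)
  refine (FatRealization.continuous_mk_comp (X := nerve (translation G)) hw
    (Kify.continuous_comp_mk (f := fun n : N => S.simplex c (p n))
      (NerveSimplex.continuous_iff hd fun i j => Kify.continuous_comp_mk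
        (((continuous_div_comp _ (hs i) (hs j)).prodMk (hd i)).subtype_mk _)))).congr fun n => ?_
  exact (classify_eq (h _ (hN n.2)).1).symm

end Numeration

/-- A principal `G`-bundle on `H`, forgetting the action of `H`, admits a continuous `G`-equivariant
map to the universal bundle if `H₀` is paracompact and Hausdorff. -/
theorem exists_classifying_map [ParacompactSpace H.Obj] [T2Space H.Obj] (P : PrincipalBundle G H) :
    ∃ f : P.Tot → UnivTotal G, Continuous f ∧ (∀ p, UnivTotal.anchor (f p) = P.anchor p) ∧
      ∀ g p w, f (P.act g p w) = UnivTotal.act (G.inv g) (f p) := by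
  obtain ⟨I, _, ⟨S⟩⟩ := P.exists_numeration
  exact ⟨S.classify, S.continuous_classify, S.anchor_classify, S.classify_act⟩

/-! ### Essential surjectivity -/

section EssSurj

variable (P : PrincipalBundle G H) {f : P.Tot → UnivTotal G}

theorem anchor_classifying_hact (hf : ∀ p, UnivTotal.anchor (f p) = P.anchor p) (h : H.Arr)
    (p : P.Tot) (w : H.src h = P.proj p) :
    UnivTotal.anchor (f p) = UnivTotal.anchor (f (P.hact h p w)) := by
  rw [hf, hf, P.anchor_hact]

theorem proj_classifying (hf : ∀ p, UnivTotal.anchor (f p) = P.anchor p)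
    (hact : ∀ g p w, f (P.act g p w) = UnivTotal.act (G.inv g) (f p)) {p q : P.Tot}
    (h : P.proj p = P.proj q) : UnivTotal.proj (f p) = UnivTotal.proj (f q) := by
  rw [← act_div h, hact, UnivTotal.proj_act (by simp [hf])]

/-- Another point of the fibre is some `g p`, and `h (g p) = g (h p)`. Equivariance of `f`
translates both components by `g⁻¹`, which stays in the same orbit. -/
theorem mk_classifying (hf : ∀ p, UnivTotal.anchor (f p) = P.anchor p)
    (hact : ∀ g p w, f (P.act g p w) = UnivTotal.act (G.inv g) (f p)) {h h' : H.Arr} {p q : P.Tot}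
    (hh : h = h') (w : H.src h = P.proj p) (w' : H.src h' = P.proj q) :
    FibArr.mk (f p) (f (P.hact h p w)) (P.anchor_classifying_hact hf _ _ _) =
      FibArr.mk (f q) (f (P.hact h' q w')) (P.anchor_classifying_hact hf _ _ _) := by
  subst hh
  have hpq : P.proj p = P.proj q := w.symm.trans w'
  obtain ⟨g, ⟨v, rfl⟩, -⟩ := P.existsUnique_act p q hpq
  have h1 : UnivTotal.anchor (f p) = G.tgt (G.inv g) := by rw [hf, G.tgt_inv, v]
  refine (FibArr.mk_act _ h1).symm.trans (FibArr.mk_congr (hact g p v).symm ?_ _)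
  rw [P.hact_act h g p w v, hact]

variable [WeaklyHausdorff G.Obj]

/-- The functor `H → fib G` given by a `G`-equivariant map to the universal bundle. -/
noncomputable def toFunctor (hc : Continuous f) (hf : ∀ p, UnivTotal.anchor (f p) = P.anchor p)
    (hact : ∀ g p w, f (P.act g p w) = UnivTotal.act (G.inv g) (f p)) :
    TopGroupoid.Hom H (fib G) where
  obj x := UnivTotal.proj (f (P.surjective_proj x).choose)
  arr h := FibArr.mk (f (P.surjective_proj (H.src h)).choose)
    (f (P.hact h (P.surjective_proj (H.src h)).choose (P.surjective_proj (H.src h)).choose_spec.symm))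
    (P.anchor_classifying_hact hf _ _ _)
  continuous_obj := P.continuous_of_comp_proj ((UnivTotal.continuous_proj.comp hc).congr fun p =>
    P.proj_classifying hf hact (P.surjective_proj (P.proj p)).choose_spec.symm)
  continuous_arr := by
    refine continuous_from_compactlyGeneratedSpace _ fun K _ _ _ h hh => ?_
    refine continuous_of_local_test fun k => ?_
    -- The chosen points over the sources may vary discontinuously. By `mk_classifying` they can be
    -- replaced locally by the values of a continuous section.
    obtain ⟨U, σ, hU, hk, hσ, hσ'⟩ := P.exists_section (H.src (h k))
    have hs : Continuous fun k => H.src (h k) := H.continuous_src.comp hh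
    refine ⟨_, (hU.preimage hs).mem_nhds hk, fun N _ hN => ?_⟩
    have h1 : Continuous fun n : N => σ (H.src (h n)) :=
      hσ.comp_continuous (hs.comp continuous_subtype_val) fun n => hN n.2
    have h2 : ∀ n : N, H.src (h n) = P.proj (σ (H.src (h n))) := fun n => (hσ' _ (hN n.2)).symm
    have h3 := P.continuous_hact N _ _ h2 (hh.comp continuous_subtype_val) h1
    refine (FibArr.continuous_mk_comp (fun n => P.anchor_classifying_hact hf _ _ (h2 n)) (hc.comp h1)
      (hc.comp h3)).congr fun n => ?_
    exact P.mk_classifying hf hact rfl _ _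
  src_arr h := rfl
  tgt_arr h := P.proj_classifying hf hact
    ((P.proj_hact _ _ _).trans (P.surjective_proj (H.tgt h)).choose_spec.symm)
  arr_one x := by
    have h := (P.surjective_proj x).choose_spec
    refine Eq.trans ?_ (FibArr.one_proj (f (P.surjective_proj x).choose)).symm
    refine (P.mk_classifying hf hact (congrArg H.one h.symm) _ (H.src_one _)).trans ?_
    exact FibArr.mk_congr rfl (congrArg f (P.hact_one _)) _
  arr_comp h' h w := by
    have v := (P.surjective_proj (H.src h)).choose_spec
    -- With `p` the point chosen over the source of `h`, the arrow of `h'` is computed at `h p`. The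
    -- composite is `[f (h p), f (h' (h p))] ∘ [f p, f (h p)]`, whose middle terms agree.
    have v' : H.src h' = P.proj (P.hact h (P.surjective_proj (H.src h)).choose v.symm) :=
      w.trans (P.proj_hact _ _ _).symm
    refine (P.mk_classifying hf hact rfl _ ((H.src_comp _ _ w).trans v.symm)).trans ?_
    refine (FibArr.mk_congr rfl (congrArg f (P.hact_comp h' h _ w v.symm)) _).trans ?_
    refine Eq.symm (((fib G).comp_congr (P.mk_classifying hf hact rfl _ v') rfl _).trans ?_)
    exact FibArr.comp_mk _ _ rfl

/-- A principal bundle is isomorphic to the bundle of the functor given by a `G`-equivariant map to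
the universal bundle. -/
noncomputable def isoOfFunctor (hc : Continuous f) (hf : ∀ p, UnivTotal.anchor (f p) = P.anchor p)
    (hact : ∀ g p w, f (P.act g p w) = UnivTotal.act (G.inv g) (f p)) :
    Iso P (ofFunctor (P.toFunctor hc hf hact)) :=
  have hproj : ∀ p, UnivTotal.proj (f p) = (P.toFunctor hc hf hact).obj (P.proj p) := fun p =>
    P.proj_classifying hf hact (P.surjective_proj (P.proj p)).choose_spec.symm
  Iso.ofMap (Q := ofFunctor (P.toFunctor hc hf hact))
    (fun p => PullbackTot.of (F := P.toFunctor hc hf hact) (P.proj p) (f p) (hproj p))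
    (continuous_from_compactlyGeneratedSpace _ fun _ _ _ _ _ ha =>
      PullbackTot.continuous_of _ (P.continuous_proj.comp ha) (hc.comp ha))
    (fun _ => rfl) hf
    (fun g p w => PullbackTot.ext' (P.proj_act g p w) (hact g p w))
    -- The arrow of `h` is `[f p, f (h p)]`, so transport along it takes `f p` to `f (h p)`.
    (fun h p w => PullbackTot.ext' (P.proj_hact h p w) (Eq.symm (FibArr.transport_eq
      (q := (P.toFunctor hc hf hact).arr h) (e := f p) (((P.toFunctor hc hf hact).src_arr h).trans
        ((congrArg (P.toFunctor hc hf hact).obj w).trans (hproj p).symm))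
      (P.anchor_classifying_hact hf _ _ _) (P.mk_classifying hf hact rfl _ w))))

end EssSurj

instance [ParacompactSpace H.Obj] [T2Space H.Obj] [WeaklyHausdorff G.Obj] :
    (functor H G).EssSurj where
  mem_essImage P := by
    obtain ⟨f, hc, hf, hact⟩ := P.exists_classifying_map
    exact ⟨P.toFunctor hc hf hact, ⟨CategoryTheory.Groupoid.isoEquivHom _ _ |>.symm
      (CategoryTheory.Groupoid.inv (P.isoOfFunctor hc hf hact : P ⟶ _))⟩⟩

instance [ParacompactSpace H.Obj] [T2Space H.Obj] [WeaklyHausdorff G.Obj] :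
    (functor H G).IsEquivalence where

end PrincipalBundle

/-- There is an equivalence of groupoids `Hom(H, fib G) ≌ M_G(H)`, natural in `H` and `G`. -/
theorem corollary3p1 :
    ∃ e : ∀ (H G : TopGroupoid.{u}) [ParacompactSpace H.Obj] [T2Space H.Obj]
        [TopGpd.WeaklyHausdorff G.Obj],
        TopGroupoid.Hom H (TopGroupoid.fib G) ≌ PrincipalBundle G H,
      Nonempty (Naturality e) :=
  ⟨fun H G _ _ _ => (PrincipalBundle.functor H G).asEquivalence, ⟨{
    mapOver := fun φ ψ _ _ α => PrincipalBundle.mapOver φ ψ α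
    mapOver_id := fun α α' h p => by
      -- A transformation is determined by its components, and the functor was defined on morphisms
      -- through `overId`.
      obtain rfl : α' = PrincipalBundle.overId α := Hom.Trans.ext (funext h)
      rfl
    mapOver_comp := fun _ _ _ _ _ _ _ α α' α'' h p =>
      PrincipalBundle.mapOver_trans α α' α'' h p }⟩⟩
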